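/- Let $d\ge 3$, $p\in(1,d]$, and $R_0,K,\theta_b,\theta_c\in(0,\infty)$. Let $b:\mathbb R^d\to\mathbb R^d$ and $c:\mathbb R^d\to\mathbb R$ be Lebesgue measurable. Write $B_R=\{x\in\mathbb R^d:|x|<R\}$ for $R\in(0,\infty]$ (so $B_\infty=\mathbb R^d$, and $R^{-1}=0$ if $R=\infty$), $r_B$ for the radius of an open ball $B\subset\mathbb R^d$ and $|B|$ for its volume. Let $M$ be the (centered) Hardy–Littlewood maximal operator, and let $[f]_{A_1}$ be the smallest constant $N\in[0,\infty]$ such that $M|f|\le N|f|$ almost everywhere. $Du$ and $D^2u$ are the gradient and the Hessian of $u$, and $|Du|$, $|D^2u|$ their Euclidean and operator norms. **Assumption on $b$** (with exponent $q_b$): $q_b\in[p,d]$, and for each ball $B$ with $r_B\le R_0$ $$\Big(\frac1{|B|}\int_B|b|^{q_b}dx\Big)^{1/q_b}\le\theta_b r_B^{-1};$$ in addition, if $p=q_b$, then $[|b|^p]_{A_1}\le K$. **Assumption on $c$** (with exponent $q_c$): $q_c\in[p,\infty)$, and either $q_c>d/2$ and $\|c\|_{L_{q_c}(\mathbb R^d)}\le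 K$, or $q_c\le d/2$ and for each ball $B$ with $r_B\le R_0$ $$\Big(\frac1{|B|}\int_B|c|^{q_c}dx\Big)^{1/q_c}\le\theta_c r_B^{-2};$$ in addition, if $p=q_c\le d/2$, then $[|c|^p]_{A_1}\le K$. **Theorem.** Let $u\in C_0^\infty(\mathbb R^d)$ be real-valued and $R\in(0,\infty]$. (i) Under the assumption on $b$, there is a constant $N_0$ depending only on $p,q_b,d,K$ such that $$\|bu\|_{L_p(B_R)}\le N_0\theta_b\|Du\|_{L_p(B_R)}+N_0\theta_b(R^{-1}+R_0^{-1})\|u\|_{L_p(B_R)},$$ $$\||b|\,|Du|\|_{L_p(B_R)}\le N_0\theta_b\|D^2u\|_{L_p(B_R)}+N_0\theta_b(R^{-1}+R_0^{-1})\|Du\|_{L_p(B_R)}.$$ (ii) Under the assumption on $c$ with $q_c>d/2$, there is a constant $N$ depending only on $p,q_c,d$ such that $$\|cu\|_{L_p(B_R)}\le NK\Big(\|D^2u\|_{L_p(B_R)}^{d/(2q_c)}\|u\|_{L_p(B_R)}^{1-d/(2q_c)}+R^{-d/q_c}\|u\|_{L_p(B_R)}\Big).$$ (iii) Under the assumption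 on $c$ with $q_c\le d/2$, there is a constant $N_0$ depending only on $p,q_c,d,K$ such that $$\|cu\|_{L_p(B_R)}\le N_0\theta_c\Big(\|D^2u\|_{L_p(B_R)}+(R_0^{-2}+R^{-2})\|u\|_{L_p(B_R)}\Big).$$ -/

import Mathlib

open MeasureTheory
open scoped ENNReal NNReal ContDiff

noncomputable section

/-- The centered Hardy–Littlewood maximal function `M|f|` on `ℝ^d`, with values in `[0, ∞]`. -/
def hlMaximal {d : ℕ} (f : EuclideanSpace ℝ (Fin d) → ℝ) (x : EuclideanSpace ℝ (Fin d)) : ℝ≥0∞ :=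
  ⨆ (r : ℝ) (_ : 0 < r), ⨍⁻ y in Metric.ball x r, ‖f y‖ₑ ∂volume

/-- The constant `[f]_{A₁}`: the smallest `N ∈ [0, ∞]` with `M|f| ≤ N |f|` almost everywhere.
It is finite exactly when `f` belongs to the Muckenhoupt class `A₁`. -/
def a1Const {d : ℕ} (f : EuclideanSpace ℝ (Fin d) → ℝ) : ℝ≥0∞ :=
  sInf {N : ℝ≥0∞ | ∀ᵐ x, hlMaximal f x ≤ N * ‖f x‖ₑ}

/-- The Morrey condition `(⨍_B |f|^q dx)^{1/q} ≤ θ r_B^{-s}` for every ball `B` of radius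
`r_B ≤ R₀`. -/
def MorreyBound {d : ℕ} {F : Type*} [NormedAddCommGroup F] (q s R₀ θ : ℝ)
    (f : EuclideanSpace ℝ (Fin d) → F) : Prop :=
  ∀ (x : EuclideanSpace ℝ (Fin d)) (r : ℝ), 0 < r → r ≤ R₀ →
    (⨍⁻ y in Metric.ball x r, ‖f y‖ₑ ^ q ∂volume) ^ (1 / q) ≤ ENNReal.ofReal (θ * r ^ (-s))

/-- The assumption on the drift `b`. -/
structure DriftAssumption {d : ℕ} (p q_b K R₀ θ_b : ℝ)
    (b : EuclideanSpace ℝ (Fin d) → EuclideanSpace ℝ (Fin d)) : Prop where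
  measurable : AEStronglyMeasurable b volume
  p_le : p ≤ q_b
  le_dim : q_b ≤ d
  morrey : MorreyBound q_b 1 R₀ θ_b b
  a1 : p = q_b → a1Const (fun x => ‖b x‖ ^ p) ≤ ENNReal.ofReal K

/-- The assumption on the zeroth-order coefficient `c`. -/
structure PotentialAssumption {d : ℕ} (p q_c K R₀ θ_c : ℝ)
    (c : EuclideanSpace ℝ (Fin d) → ℝ) : Prop where
  measurable : AEStronglyMeasurable c volume
  p_le : p ≤ q_c
  cases : ((d : ℝ) / 2 < q_c ∧ eLpNorm c (ENNReal.ofReal q_c) volume ≤ ENNReal.ofReal K) ∨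
    (q_c ≤ (d : ℝ) / 2 ∧ MorreyBound q_c 2 R₀ θ_c c)
  a1 : p = q_c → q_c ≤ (d : ℝ) / 2 → a1Const (fun x => |c x| ^ p) ≤ ENNReal.ofReal K

/-- The norm `‖f‖_{L_p(B_R)}`, where `B_R = {|x| < R}` for `R ∈ (0, ∞]`, and so `B_∞ = ℝ^d`. -/
def lpBall {d : ℕ} {F : Type*} [NormedAddCommGroup F] (p : ℝ) (R : ℝ≥0∞)
    (f : EuclideanSpace ℝ (Fin d) → F) : ℝ≥0∞ :=
  eLpNorm f (ENNReal.ofReal p) (volume.restrict (Metric.eball 0 R))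

end

/-! Each estimate combines a pointwise bound of a smooth function by a truncated Riesz potential
with a weighted bound for that potential.

Pointwise bound. For `x` in `B_R` and a scale `ρ ≤ R`, join `x` to the points of a ball of radius `ρ
/ 2` inside `B_R` and average the fundamental theorem of calculus along these segments, or its
second-difference version (`le_rieszSum_of_forall_segment`). Thus `|v(x)|` is at most a constant
times the order-`α` potential of `(|D^α v| + ρ^{-α} |v|) 1_{B_R}`, with `α = 1` or `2`. By convexity
everything stays in `B_R`, so no extension theorem is needed. For `α = 2` no gradient term appears.

Weighted bound. It remains to bound `f · I_α g` in `L_p` by `C θ ‖g‖_p`. The one-third trick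
(`exists_ball_subset_cell`) replaces balls by cubes of `2^d` nested grids, and duality
(`lintegral_rpow_le_of_forall_dual`) turns the claim into an estimate of `∫ β F ∑ c_k E_k g`, where
`β = |f|`, `E_k` averages over cells of level `k`, and `c_k` decays geometrically. Bound `E_k g` by
the running maximum of the averages and sum by parts in `k` (`lintegral_mul_sum_cellAvg_le`). The
increment at level `j` is constant on cells of that level, so only `c_j E_j(β F)` has to be
controlled, uniformly in `j`. If `q > p`, Hölder on a cell and the Morrey condition give `θ (E_j
F^s)^{1/s}` with `s < p'`. If `q = p`, this would require the maximal inequality at its endpoint;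
instead `β F` is averaged against the measure `β^p dx`, and the A₁ condition bounds the remaining
power of `E_j β^p` pointwise. Hölder and Doob's inequality (`lintegral_cellMax_rpow_le`) then
conclude.

For (i) and (iii), `ρ` is comparable to `min(R, R₀)`. For (ii), each dyadic level gains a factor
`2^{-δ}`, `δ = 2 - d/q_c`, so the levels can be summed one by one for every `ρ ≤ R`; optimizing over
`ρ` (`le_interpolation`) gives the multiplicative inequality. -/

set_option linter.unusedSectionVars false

/-! ### Conditional expectations on countable partitions. -/

section Averages

variable {X ι : Type*} [MeasurableSpace X] [Countable ι] [MeasurableSpace ι]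
  [MeasurableSingletonClass ι]

/-- The average of `h` over the fibre of `π` through `x`. -/
noncomputable def cellAvg (μ : Measure X) (π : X → ι) (h : X → ℝ≥0∞) (x : X) : ℝ≥0∞ :=
  (∫⁻ y in π ⁻¹' {π x}, h y ∂μ) / μ (π ⁻¹' {π x})

lemma measurable_of_factorsThrough {π : X → ι} (hπ : Measurable π) {Ψ : X → ℝ≥0∞}
    (hΨ : Function.FactorsThrough Ψ π) : Measurable Ψ := by
  obtain ⟨ψ, rfl⟩ := (Function.factorsThrough_iff Ψ).1 hΨ
  exact (measurable_of_countable ψ).comp hπ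

lemma cellAvg_factorsThrough (μ : Measure X) (π : X → ι) (h : X → ℝ≥0∞) :
    Function.FactorsThrough (cellAvg μ π h) π := by
  intro x y hxy
  simp only [cellAvg, hxy]

lemma measurable_cellAvg (μ : Measure X) {π : X → ι} (hπ : Measurable π) (h : X → ℝ≥0∞) :
    Measurable (cellAvg μ π h) :=
  measurable_of_factorsThrough hπ (cellAvg_factorsThrough μ π h)

lemma lintegral_eq_tsum_fiber (μ : Measure X) {π : X → ι} (hπ : Measurable π) (f : X → ℝ≥0∞) :
    ∫⁻ x, f x ∂μ = ∑' i, ∫⁻ x in π ⁻¹' {i}, f x ∂μ := by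
  rw [← lintegral_iUnion (fun i => hπ (measurableSet_singleton i))]
  · rw [← Set.preimage_iUnion, Set.iUnion_of_singleton, Set.preimage_univ, Measure.restrict_univ]
  · intro i j hij
    exact Disjoint.preimage _ (by simpa using hij)

/-- The defining property of conditional expectation: on each fibre `Ψ` is a constant and comes out
of the integral. It is the tool for moving averages from one factor to another. -/
lemma lintegral_cellAvg_mul {μ : Measure X} {π : X → ι} (hπ : Measurable π)
    (hfin : ∀ x, μ (π ⁻¹' {π x}) ≠ ⊤) {h : X → ℝ≥0∞} (hh : Measurable h) {Ψ : X → ℝ≥0∞}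
    (hΨ : Function.FactorsThrough Ψ π) :
    ∫⁻ x, cellAvg μ π h x * Ψ x ∂μ = ∫⁻ x, h x * Ψ x ∂μ := by
  obtain ⟨ψ, rfl⟩ := (Function.factorsThrough_iff Ψ).1 hΨ
  rw [lintegral_eq_tsum_fiber μ hπ, lintegral_eq_tsum_fiber μ hπ]
  refine tsum_congr fun i => ?_
  have hm : MeasurableSet (π ⁻¹' {i}) := hπ (measurableSet_singleton i)
  have h1 : ∫⁻ x in π ⁻¹' {i}, cellAvg μ π h x * (ψ ∘ π) x ∂μ =
      ∫⁻ x in π ⁻¹' {i}, ((∫⁻ y in π ⁻¹' {i}, h y ∂μ) / μ (π ⁻¹' {i})) * ψ i ∂μ := by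
    refine setLIntegral_congr_fun hm fun x hx => ?_
    have hx : π x = i := hx
    simp only [cellAvg, hx, Function.comp]
  have h2 : ∫⁻ x in π ⁻¹' {i}, h x * (ψ ∘ π) x ∂μ =
      ∫⁻ x in π ⁻¹' {i}, h x * ψ i ∂μ := by
    refine setLIntegral_congr_fun hm fun x hx => ?_
    have hx : π x = i := hx
    simp only [hx, Function.comp]
  rw [h1, h2, lintegral_mul_const _ hh, setLIntegral_const]
  by_cases h0 : μ (π ⁻¹' {i}) = 0
  · simp [h0, Measure.restrict_eq_zero.2 h0]
  · have hne : μ (π ⁻¹' {i}) ≠ ⊤ := by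
      obtain ⟨x, hx⟩ := nonempty_of_measure_ne_zero h0
      have hx : π x = i := hx
      exact hx ▸ hfin x
    rw [mul_right_comm, ENNReal.div_mul_cancel h0 hne]

/-- Hölder on one cell; the normalizing factor splits between the two averages because `1/a + 1/b =
1`. -/
lemma cellAvg_mul_le {μ : Measure X} {π : X → ι} {a b : ℝ}
    (hab : a.HolderConjugate b) {f g : X → ℝ≥0∞} (hf : Measurable f) (hg : Measurable g) (x : X) :
    cellAvg μ π (fun y => f y * g y) x ≤
      cellAvg μ π (fun y => f y ^ a) x ^ (1 / a) * cellAvg μ π (fun y => g y ^ b) x ^ (1 / b) := by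
  unfold cellAvg
  set s := π ⁻¹' {π x}
  have h := ENNReal.lintegral_mul_le_Lp_mul_Lq (μ.restrict s) hab hf.aemeasurable hg.aemeasurable
  have ha : 0 ≤ 1 / a := hab.one_div_nonneg
  have hb : 0 ≤ 1 / b := hab.symm.one_div_nonneg
  have hs : 1 / a + 1 / b = 1 := by simpa using hab.inv_add_inv_eq_one
  simp only [div_eq_mul_inv (∫⁻ _, _ ∂_), ENNReal.mul_rpow_of_nonneg _ _ ha,
    ENNReal.mul_rpow_of_nonneg _ _ hb]
  calc _ ≤ _ := mul_le_mul_left h _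
    _ = _ := by
      have e : (μ s)⁻¹ = (μ s)⁻¹ ^ (1 / a) * (μ s)⁻¹ ^ (1 / b) := by
        rw [← ENNReal.rpow_add_of_nonneg _ _ ha hb, hs, ENNReal.rpow_one]
      nth_rw 1 [e]
      ring

/-- Jensen, as Hölder against the constant `1`. The average of `1` is only known to be at most `1`,
since a cell may be null or of infinite measure. -/
lemma cellAvg_rpow_le {μ : Measure X} {π : X → ι} {a : ℝ} (ha : 1 ≤ a)
    {f : X → ℝ≥0∞} (hf : Measurable f) (x : X) :
    cellAvg μ π f x ^ a ≤ cellAvg μ π (fun y => f y ^ a) x := by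
  rcases ha.eq_or_lt with rfl | ha
  · simp
  have hab := Real.HolderConjugate.conjExponent ha
  have h := cellAvg_mul_le (μ := μ) (π := π) hab hf (measurable_const (a := (1 : ℝ≥0∞))) x
  have h1 : cellAvg μ π (fun _ => (1 : ℝ≥0∞) ^ a.conjExponent) x ≤ 1 := by
    simp only [cellAvg, ENNReal.one_rpow, lintegral_one, Measure.restrict_apply_univ]
    exact ENNReal.div_self_le_one
  simp only [mul_one] at h
  have h2 := h.trans (mul_le_mul_right (ENNReal.rpow_le_one h1 hab.symm.one_div_nonneg) _)
  rw [mul_one, one_div] at h2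
  exact (ENNReal.le_rpow_inv_iff hab.pos).1 h2

lemma lintegral_cellAvg_rpow_le {μ : Measure X} {π : X → ι} (hπ : Measurable π)
    (hfin : ∀ x, μ (π ⁻¹' {π x}) ≠ ⊤) {a : ℝ} (ha : 1 ≤ a) {h : X → ℝ≥0∞} (hh : Measurable h) :
    ∫⁻ x, cellAvg μ π h x ^ a ∂μ ≤ ∫⁻ x, h x ^ a ∂μ := by
  calc _ ≤ ∫⁻ x, cellAvg μ π (fun y => h y ^ a) x * (fun _ => 1) x ∂μ := by
        refine lintegral_mono fun x => ?_
        simpa using cellAvg_rpow_le ha hh x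
    _ = _ := by
        rw [lintegral_cellAvg_mul hπ hfin (hh.pow_const a) (fun _ _ _ => rfl)]
        simp

/-! ### Doob's maximal inequality and summation by parts over levels. -/

/-- If `I ≤ C I^{1/q'}` with `I` finite, then `I^{1/q} ≤ C`. -/
lemma rpow_le_of_le_mul_rpow_conj {q r : ℝ} (hqr : q.HolderConjugate r) {I C : ℝ≥0∞}
    (hI : I ≠ ⊤) (h : I ≤ C * I ^ (1 / r)) : I ^ (1 / q) ≤ C := by
  rcases eq_or_ne I 0 with rfl | h0
  · simp [hqr.pos]
  have hs : 1 / q + 1 / r = 1 := by simpa using hqr.inv_add_inv_eq_one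
  have e : I = I ^ (1 / q) * I ^ (1 / r) := by
    rw [← ENNReal.rpow_add _ _ h0 hI, hs, ENNReal.rpow_one]
  nth_rw 1 [e] at h
  refine (ENNReal.mul_le_mul_iff_left ?_ ?_).1 h
  · exact (ENNReal.rpow_pos (pos_iff_ne_zero.2 h0) hI).ne'
  · exact ENNReal.rpow_ne_top_of_nonneg hqr.symm.one_div_nonneg hI

/-- Numerical core of Doob's inequality. Young gives `r a m^{q-1} ≤ (r/q) a^q + m^q`, and `r/q = r -
1`; the rest is rearrangement. -/
lemma rpow_le_rpow_add_young {q r : ℝ} (hqr : q.HolderConjugate r) {a m : ℝ≥0∞} (hma : m ≤ a) :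
    a ^ q ≤ m ^ q + ENNReal.ofReal r * (a * (a ^ (q - 1) - m ^ (q - 1))) := by
  have hq1 : 0 < q - 1 := hqr.sub_one_pos
  have hr : 0 < r := hqr.symm.pos
  rcases eq_or_ne m ⊤ with rfl | hm
  · simp [hqr.pos]
  rcases eq_or_ne a ⊤ with rfl | ha
  · have : (⊤ : ℝ≥0∞) ^ (q - 1) - m ^ (q - 1) = ⊤ := by
      rw [ENNReal.top_rpow_of_pos hq1]
      exact ENNReal.top_sub (ENNReal.rpow_ne_top_of_nonneg hq1.le hm)
    rw [this]
    simp [hr]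
  have hpow : m ^ (q - 1) ≤ a ^ (q - 1) := ENNReal.rpow_le_rpow hma hq1.le
  lift a to ℝ≥0 using ha
  lift m to ℝ≥0 using hm
  have hy := Real.young_inequality_of_nonneg (a := a) (b := (m : ℝ) ^ (q - 1)) a.coe_nonneg
    (Real.rpow_nonneg m.coe_nonneg _) hqr
  rw [← Real.rpow_mul (NNReal.coe_nonneg m), hqr.sub_one_mul_conj] at hy
  have hmle : (m : ℝ) ^ (q - 1) ≤ (a : ℝ) ^ (q - 1) :=
    Real.rpow_le_rpow m.coe_nonneg (by exact_mod_cast hma) hq1.le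
  have e2 : (a : ℝ) * a ^ (q - 1) = a ^ q := by
    rcases eq_or_ne (a : ℝ) 0 with h0 | h0
    · rw [h0, Real.zero_rpow hqr.ne_zero, zero_mul]
    · rw [Real.rpow_sub_one h0, mul_div_cancel₀ _ h0]
  have hrq : r / q = r - 1 := by
    have := hqr.symm.sub_one_mul_conj
    field_simp [hqr.ne_zero]
    linarith
  have key : (a : ℝ) ^ q ≤ m ^ q + r * (a * (a ^ (q - 1) - m ^ (q - 1))) := by
    have h3 : r * (a * (m : ℝ) ^ (q - 1)) ≤ (r - 1) * a ^ q + m ^ q := by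
      calc _ ≤ r * ((a : ℝ) ^ q / q + m ^ q / r) := mul_le_mul_of_nonneg_left hy hr.le
        _ = r / q * a ^ q + m ^ q := by field_simp
        _ = _ := by rw [hrq]
    rw [mul_sub, mul_sub, e2]
    linarith
  have c1 : ∀ t : ℝ≥0, ∀ s : ℝ, 0 ≤ s → (t : ℝ≥0∞) ^ s = ENNReal.ofReal ((t : ℝ) ^ s) := by
    intro t s hs
    rw [← ENNReal.ofReal_coe_nnreal, ENNReal.ofReal_rpow_of_nonneg t.coe_nonneg hs]
  rw [c1 _ _ hqr.pos.le, c1 _ _ hqr.pos.le, c1 _ _ hq1.le, c1 _ _ hq1.le,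
    ← ENNReal.ofReal_sub _ (by positivity), ← ENNReal.ofReal_coe_nnreal,
    ← ENNReal.ofReal_mul (by positivity), ← ENNReal.ofReal_mul hr.le,
    ← ENNReal.ofReal_add (by positivity)
      (mul_nonneg hr.le (mul_nonneg a.coe_nonneg (sub_nonneg.2 hmle)))]
  exact ENNReal.ofReal_le_ofReal key

/-- The running maximum of the averages of `h` along a sequence of partitions. -/
noncomputable def cellMax (μ : Measure X) (π : ℕ → X → ι) (h : X → ℝ≥0∞) : ℕ → X → ℝ≥0∞
  | 0 => cellAvg μ (π 0) h
  | n + 1 => fun x => cellMax μ π h n x ⊔ cellAvg μ (π (n + 1)) h x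

lemma cellAvg_le_cellMax (μ : Measure X) (π : ℕ → X → ι) (h : X → ℝ≥0∞) {j n : ℕ} (hj : j ≤ n)
    (x : X) : cellAvg μ (π j) h x ≤ cellMax μ π h n x := by
  induction n with
  | zero => obtain rfl : j = 0 := by omega
            exact le_rfl
  | succ n ih =>
    rcases Nat.lt_or_ge n j with h1 | h1
    · obtain rfl : j = n + 1 := by omega
      exact le_sup_right
    · exact (ih h1).trans le_sup_left

/-- The increments of a nondecreasing sequence. -/
def increment (M : ℕ → ℝ≥0∞) : ℕ → ℝ≥0∞
  | 0 => M 0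
  | n + 1 => M (n + 1) - M n

lemma sum_increment {M : ℕ → ℝ≥0∞} (hM : Monotone M) (n : ℕ) :
    ∑ k ∈ Finset.range (n + 1), increment M k = M n := by
  induction n with
  | zero => simp [increment]
  | succ n ih => rw [Finset.sum_range_succ, ih]; exact add_tsub_cancel_of_le (hM n.le_succ)

lemma cellMax_monotone (μ : Measure X) (π : ℕ → X → ι) (h : X → ℝ≥0∞) (x : X) :
    Monotone fun n => cellMax μ π h n x :=
  monotone_nat_of_le_succ fun _ => le_sup_left

variable {π : ℕ → X → ι}

lemma cellMax_factorsThrough (href : ∀ k, Function.FactorsThrough (π k) (π (k + 1)))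
    (μ : Measure X) (h : X → ℝ≥0∞) (n : ℕ) :
    Function.FactorsThrough (cellMax μ π h n) (π n) := by
  induction n with
  | zero => exact cellAvg_factorsThrough μ (π 0) h
  | succ n ih =>
    intro x y hxy
    simp only [cellMax]
    rw [ih (href n hxy), cellAvg_factorsThrough μ (π (n + 1)) h hxy]

lemma increment_factorsThrough (href : ∀ k, Function.FactorsThrough (π k) (π (k + 1)))
    (μ : Measure X) (h : X → ℝ≥0∞) (φ : ℝ≥0∞ → ℝ≥0∞) (n : ℕ) :
    Function.FactorsThrough (fun x => increment (fun k => φ (cellMax μ π h k x)) n) (π n) := by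
  intro x y hxy
  cases n with
  | zero => simp only [increment]; rw [cellMax_factorsThrough href μ h 0 hxy]
  | succ n =>
    simp only [increment]
    rw [cellMax_factorsThrough href μ h (n + 1) hxy, cellMax_factorsThrough href μ h n (href n hxy)]

lemma measurable_cellMax (hπ : ∀ k, Measurable (π k))
    (href : ∀ k, Function.FactorsThrough (π k) (π (k + 1))) (μ : Measure X) (h : X → ℝ≥0∞)
    (n : ℕ) : Measurable (cellMax μ π h n) :=
  measurable_of_factorsThrough (hπ n) (cellMax_factorsThrough href μ h n)

/-- Telescoping in the level. An increment vanishes unless the new average is the new maximum, so it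
may be multiplied by the average, which is linear in `h`, instead of the maximum. -/
lemma cellMax_rpow_le_sum {q r : ℝ} (hqr : q.HolderConjugate r) (μ : Measure X) (h : X → ℝ≥0∞)
    (n : ℕ) (x : X) :
    cellMax μ π h n x ^ q ≤ ∑ k ∈ Finset.range (n + 1), ENNReal.ofReal r *
      (cellAvg μ (π k) h x * increment (fun k => cellMax μ π h k x ^ (q - 1)) k) := by
  have step : ∀ {a m : ℝ≥0∞}, (m ⊔ a) ^ q ≤
      m ^ q + ENNReal.ofReal r * (a * ((m ⊔ a) ^ (q - 1) - m ^ (q - 1))) := by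
    intro a m
    rcases le_total a m with h | h
    · rw [sup_eq_left.2 h]; exact le_self_add
    · rw [sup_eq_right.2 h]; exact rpow_le_rpow_add_young hqr h
  induction n with
  | zero =>
    simpa [increment, cellMax, hqr.pos, hqr.sub_one_pos] using
      rpow_le_rpow_add_young hqr (zero_le (a := cellAvg μ (π 0) h x))
  | succ n ih =>
    rw [Finset.sum_range_succ]
    exact step.trans (add_le_add_left ih _)

/-- **Doob's maximal inequality** along a sequence of refining countable partitions. -/
theorem lintegral_cellMax_rpow_le {q r : ℝ} (hqr : q.HolderConjugate r)
    (hπ : ∀ k, Measurable (π k)) (href : ∀ k, Function.FactorsThrough (π k) (π (k + 1)))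
    {μ : Measure X} (hfin : ∀ k x, μ (π k ⁻¹' {π k x}) ≠ ⊤) {h : X → ℝ≥0∞} (hh : Measurable h)
    (n : ℕ) :
    (∫⁻ x, cellMax μ π h n x ^ q ∂μ) ^ (1 / q) ≤
      ENNReal.ofReal r * (∫⁻ x, h x ^ q ∂μ) ^ (1 / q) := by
  have hq := hqr.pos
  have hr := hqr.symm.pos
  rcases eq_or_ne (∫⁻ x, h x ^ q ∂μ) ⊤ with htop | htop
  · rw [htop, ENNReal.top_rpow_of_pos (by positivity), ENNReal.mul_top (by simpa using hr)]
    exact le_top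
  have hMm := measurable_cellMax hπ href μ h
  have hmono : ∀ x, Monotone fun k => cellMax μ π h k x ^ (q - 1) := fun x i j hij =>
    ENNReal.rpow_le_rpow (cellMax_monotone μ π h x hij) hqr.sub_one_pos.le
  -- Qualitative finiteness, needed to absorb the power of the maximum at the end.
  have hImono : ∫⁻ x, cellMax μ π h n x ^ q ∂μ ≠ ⊤ := by
    induction n with
    | zero => exact ((lintegral_cellAvg_rpow_le (hπ 0) (hfin 0) hqr.lt.le hh).trans_lt
        (lt_top_iff_ne_top.2 htop)).ne
    | succ n ih =>
      have h2 := (lintegral_cellAvg_rpow_le (hπ (n+1)) (hfin (n+1)) hqr.lt.le hh).trans_lt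
        (lt_top_iff_ne_top.2 htop)
      refine (lt_of_le_of_lt ?_ (ENNReal.add_lt_top.2 ⟨lt_top_iff_ne_top.2 ih, h2⟩)).ne
      rw [← lintegral_add_left ((hMm n).pow_const q)]
      refine lintegral_mono fun x => ?_
      simp only [cellMax]
      rcases le_total (cellAvg μ (π (n + 1)) h x) (cellMax μ π h n x) with h | h
      · rw [sup_eq_left.2 h]; exact le_self_add
      · rw [sup_eq_right.2 h]; exact le_add_self
  refine rpow_le_of_le_mul_rpow_conj hqr hImono ?_
  have hinc := increment_factorsThrough href μ h (fun t => t ^ (q - 1))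
  have hincm : ∀ k, Measurable fun x => increment (fun k => cellMax μ π h k x ^ (q - 1)) k :=
    fun k => measurable_of_factorsThrough (hπ k) (hinc k)
  calc ∫⁻ x, cellMax μ π h n x ^ q ∂μ
      ≤ ∫⁻ x, ∑ k ∈ Finset.range (n + 1), ENNReal.ofReal r *
      (cellAvg μ (π k) h x * increment (fun k => cellMax μ π h k x ^ (q - 1)) k) ∂μ :=
        lintegral_mono fun x => cellMax_rpow_le_sum hqr μ h n x
    -- The increment at level `k` is constant on cells of that level, so the average of `h` may be
    -- replaced by `h`; the increments then telescope.
    _ = ∑ k ∈ Finset.range (n + 1), ENNReal.ofReal r *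
      ∫⁻ x, h x * increment (fun k => cellMax μ π h k x ^ (q - 1)) k ∂μ := by
        rw [lintegral_finsetSum]
        · refine Finset.sum_congr rfl fun k _ => ?_
          rw [lintegral_const_mul, lintegral_cellAvg_mul (hπ k) (hfin k) hh (hinc k)]
          exact (measurable_cellAvg μ (hπ k) h).mul (hincm k)
        · exact fun k _ => ((measurable_cellAvg μ (hπ k) h).mul (hincm k)).const_mul _
    _ = ENNReal.ofReal r * ∫⁻ x, h x * cellMax μ π h n x ^ (q - 1) ∂μ := by
        rw [← Finset.mul_sum, ← lintegral_finsetSum]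
        · congr 1
          refine lintegral_congr fun x => ?_
          rw [← Finset.mul_sum, sum_increment (hmono x)]
        · exact fun k _ => hh.mul (hincm k)
    _ ≤ ENNReal.ofReal r * ((∫⁻ x, h x ^ q ∂μ) ^ (1 / q) *
          (∫⁻ x, (cellMax μ π h n x ^ (q - 1)) ^ r ∂μ) ^ (1 / r)) := by
        gcongr
        exact ENNReal.lintegral_mul_le_Lp_mul_Lq μ hqr hh.aemeasurable
          ((hMm n).pow_const _).aemeasurable
    _ = _ := by
        simp only [← ENNReal.rpow_mul, hqr.sub_one_mul_conj]
        rw [mul_assoc]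

/-- Summation by parts in the levels of a filtration: averages of `g` are replaced by increments of
their running maximum, which are measurable at the level at which `F` is then averaged. -/
theorem lintegral_mul_sum_cellAvg_le (hπ : ∀ k, Measurable (π k))
    (href : ∀ k, Function.FactorsThrough (π k) (π (k + 1)))
    {μ : Measure X} (hfin : ∀ k x, μ (π k ⁻¹' {π k x}) ≠ ⊤) {c : ℕ → ℝ≥0∞} {C : ℝ≥0∞}
    (hc : ∀ j n, ∑ k ∈ Finset.Ico j n, c k ≤ C * c j) {F g H : X → ℝ≥0∞} (hF : Measurable F)
    (hHm : Measurable H) (n : ℕ) (hH : ∀ j ≤ n, ∀ᵐ x ∂μ, c j * cellAvg μ (π j) F x ≤ H x) :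
    ∫⁻ x, F x * ∑ k ∈ Finset.range (n + 1), c k * cellAvg μ (π k) g x ∂μ ≤
      C * ∫⁻ x, H x * cellMax μ π g n x ∂μ := by
  have hinc := increment_factorsThrough href μ g id
  have hincm : ∀ k, Measurable fun x => increment (fun k => cellMax μ π g k x) k :=
    fun k => measurable_of_factorsThrough (hπ k) (hinc k)
  have hpt : ∀ x, ∑ k ∈ Finset.range (n + 1), c k * cellAvg μ (π k) g x ≤
      ∑ j ∈ Finset.range (n + 1), C * (c j * increment (fun k => cellMax μ π g k x) j) := by
    intro x
    calc _ ≤ ∑ k ∈ Finset.range (n + 1), ∑ j ∈ Finset.range (k + 1),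
            c k * increment (fun k => cellMax μ π g k x) j := by
          refine Finset.sum_le_sum fun k _ => ?_
          rw [← Finset.mul_sum, sum_increment (cellMax_monotone μ π g x)]
          gcongr
          exact cellAvg_le_cellMax μ π g le_rfl x
      _ = ∑ j ∈ Finset.range (n + 1), ∑ k ∈ Finset.Ico j (n + 1),
            c k * increment (fun k => cellMax μ π g k x) j := by
          refine Finset.sum_comm' fun a b => ?_
          simp only [Finset.mem_range, Finset.mem_Ico]
          omega
      _ ≤ _ := by
          refine Finset.sum_le_sum fun j _ => ?_
          rw [← Finset.sum_mul, ← mul_assoc]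
          gcongr
          exact hc j _
  calc _ ≤ ∫⁻ x, ∑ j ∈ Finset.range (n + 1),
          C * (c j * (F x * increment (fun k => cellMax μ π g k x) j)) ∂μ := by
        refine lintegral_mono fun x => (mul_le_mul_right (hpt x) _).trans_eq ?_
        rw [Finset.mul_sum]
        exact Finset.sum_congr rfl fun j _ => by ring
    -- Since the `j`-th increment is constant on level-`j` cells, `F` may be replaced by its average
    -- there.
    _ = ∑ j ∈ Finset.range (n + 1), C * ∫⁻ x,
          (c j * cellAvg μ (π j) F x) * increment (fun k => cellMax μ π g k x) j ∂μ := by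
        rw [lintegral_finsetSum]
        · refine Finset.sum_congr rfl fun j _ => ?_
          have hm : Measurable fun x => cellAvg μ (π j) F x *
              increment (fun k => cellMax μ π g k x) j :=
            (measurable_cellAvg μ (hπ j) F).mul (hincm j)
          simp only [mul_assoc (c j)]
          rw [lintegral_const_mul _ (by fun_prop), lintegral_const_mul _ (by fun_prop),
            lintegral_const_mul _ hm]
          exact congrArg _ (congrArg _ (lintegral_cellAvg_mul (hπ j) (hfin j) hF (hinc j)).symm)
        · exact fun j _ => ((hF.mul (hincm j)).const_mul _).const_mul _
    _ ≤ ∑ j ∈ Finset.range (n + 1), C * ∫⁻ x,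
          H x * increment (fun k => cellMax μ π g k x) j ∂μ := by
        refine Finset.sum_le_sum fun j hj => ?_
        gcongr C * ?_
        refine lintegral_mono_ae ?_
        filter_upwards [hH j (by simpa [Nat.lt_succ_iff] using hj)] with x hx
        gcongr
    _ ≤ _ := by
        rw [← Finset.mul_sum]
        gcongr C * ?_
        have hm : ∀ j ∈ Finset.range (n + 1), Measurable fun x =>
            H x * increment (fun k => cellMax μ π g k x) j := fun j _ => hHm.mul (hincm j)
        rw [← lintegral_finsetSum _ hm]
        refine lintegral_mono fun x => ?_
        rw [← Finset.mul_sum, sum_increment (cellMax_monotone μ π g x)]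

end Averages

/-! ### `L_p` norms by duality. -/

section Duality

variable {X : Type*} [MeasurableSpace X]

/-- The converse of Hölder's inequality. -/
theorem lintegral_rpow_le_of_forall_dual {p r : ℝ} (hpr : p.HolderConjugate r) {μ : Measure X}
    [SigmaFinite μ] {φ : X → ℝ≥0∞} (hφ : Measurable φ) {A : ℝ≥0∞}
    (h : ∀ f : X → ℝ≥0∞, Measurable f → ∫⁻ x, φ x * f x ∂μ ≤ A * (∫⁻ x, f x ^ r ∂μ) ^ (1 / r)) :
    (∫⁻ x, φ x ^ p ∂μ) ^ (1 / p) ≤ A := by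
  have hp := hpr.pos
  have hp1 := hpr.sub_one_pos
  -- Truncation in height and support makes the integral of `ψ^p` finite, so that testing with
  -- `ψ^{p-1}` gives an inequality that can be absorbed; Fatou removes the truncation.
  set ψ : ℕ → X → ℝ≥0∞ := fun m => (spanningSets μ m).indicator fun x => min (φ x) m
  have hψm : ∀ m, Measurable (ψ m) := fun m =>
    (hφ.min measurable_const).indicator (measurableSet_spanningSets μ m)
  have hle : ∀ m x, ψ m x ≤ φ x := fun m x =>
    Set.indicator_le (fun _ _ => min_le_left _ _) x
  have hψ : ∀ m, (∫⁻ x, ψ m x ^ p ∂μ) ≤ A ^ p := by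
    intro m
    have hfin : ∫⁻ x, ψ m x ^ p ∂μ ≠ ⊤ := by
      have h1 : ∫⁻ x, ψ m x ^ p ∂μ ≤
          ∫⁻ x, (spanningSets μ m).indicator (fun _ => (m : ℝ≥0∞) ^ p) x ∂μ := by
        refine lintegral_mono fun x => ?_
        by_cases hx : x ∈ spanningSets μ m
        · simp only [ψ, Set.indicator_of_mem hx]
          exact ENNReal.rpow_le_rpow (min_le_right _ _) hp.le
        · simp [ψ, Set.indicator_of_notMem hx, hp]
      refine ne_top_of_le_ne_top ?_ h1
      rw [lintegral_indicator_const (measurableSet_spanningSets μ m)]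
      exact ENNReal.mul_ne_top (ENNReal.rpow_ne_top_of_nonneg hp.le (by simp))
        (measure_spanningSets_lt_top μ m).ne
    have h2 : (∫⁻ x, ψ m x ^ p ∂μ) ≤ A * (∫⁻ x, ψ m x ^ p ∂μ) ^ (1 / r) := by
      calc ∫⁻ x, ψ m x ^ p ∂μ ≤ ∫⁻ x, φ x * ψ m x ^ (p - 1) ∂μ := by
            refine lintegral_mono fun x => ?_
            have : ψ m x ^ p = ψ m x * ψ m x ^ (p - 1) := by
              nth_rw 2 [← ENNReal.rpow_one (ψ m x)]
              rw [← ENNReal.rpow_add_of_nonneg _ _ zero_le_one hp1.le]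
              congr 1; ring
            simp only [this]
            gcongr
            exact hle m x
        _ ≤ A * (∫⁻ x, (ψ m x ^ (p - 1)) ^ r ∂μ) ^ (1 / r) := h _ ((hψm m).pow_const _)
        _ = _ := by simp only [← ENNReal.rpow_mul, hpr.sub_one_mul_conj]
    have h3 := rpow_le_of_le_mul_rpow_conj hpr hfin h2
    rwa [one_div, ENNReal.rpow_inv_le_iff hp] at h3
  rw [one_div, ENNReal.rpow_inv_le_iff hp]
  have hlim : ∀ x, Filter.Tendsto (fun m => ψ m x ^ p) Filter.atTop (nhds (φ x ^ p)) := by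
    intro x
    refine (ENNReal.continuous_rpow_const.tendsto _).comp ?_
    have h1 : Filter.Tendsto (fun m : ℕ => min (φ x) (m : ℝ≥0∞)) Filter.atTop (nhds (φ x)) := by
      simpa using (tendsto_const_nhds (x := φ x)).min ENNReal.tendsto_nat_nhds_top
    refine h1.congr' ?_
    filter_upwards [eventually_mem_spanningSets μ x] with m hm
    simp only [ψ, Set.indicator_of_mem hm]
  calc ∫⁻ x, φ x ^ p ∂μ = ∫⁻ x, Filter.liminf (fun m => ψ m x ^ p) Filter.atTop ∂μ :=
        lintegral_congr fun x => (hlim x).liminf_eq.symm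
    _ ≤ Filter.liminf (fun m => ∫⁻ x, ψ m x ^ p ∂μ) Filter.atTop :=
        lintegral_liminf_le fun m => (hψm m).pow_const _
    _ ≤ A ^ p := Filter.liminf_le_of_le (by isBoundedDefault) fun b hb => by
        obtain ⟨m, hm⟩ := hb.exists
        exact hm.trans (hψ m)

end Duality

/-! ### Bilinear dyadic estimates: Morrey, A₁ and subcritical weights. -/

section Bilinear

variable {X ι : Type*} [MeasurableSpace X] [Countable ι] [MeasurableSpace ι]
  [MeasurableSingletonClass ι] {π : ℕ → X → ι} {μ : Measure X} {c : ℕ → ℝ≥0∞} {C θ : ℝ≥0∞}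
  {β f g : X → ℝ≥0∞}

/-- The bilinear estimate under a Morrey condition with an exponent `q > p`. -/
theorem lintegral_mul_sum_cellAvg_le_of_morrey {p r q s t t' : ℝ} (hpr : p.HolderConjugate r)
    (hqs : q.HolderConjugate s) (ht : t.HolderConjugate t') (hts : t * s = r)
    (hπ : ∀ k, Measurable (π k)) (href : ∀ k, Function.FactorsThrough (π k) (π (k + 1)))
    (hfin : ∀ k x, μ (π k ⁻¹' {π k x}) ≠ ⊤)
    (hc : ∀ j n, ∑ k ∈ Finset.Ico j n, c k ≤ C * c j) (hβ : Measurable β)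
    (hθ : ∀ k x, c k * cellAvg μ (π k) (fun y => β y ^ q) x ^ (1 / q) ≤ θ)
    (hf : Measurable f) (hg : Measurable g) (n : ℕ) :
    ∫⁻ x, β x * f x * ∑ k ∈ Finset.range (n + 1), c k * cellAvg μ (π k) g x ∂μ ≤
      C * (ENNReal.ofReal r * ENNReal.ofReal t' ^ (1 / s)) * θ *
        (∫⁻ x, f x ^ r ∂μ) ^ (1 / r) * (∫⁻ x, g x ^ p ∂μ) ^ (1 / p) := by
  have hs := hqs.symm.pos
  set M := cellMax μ π (fun y => f y ^ s) n
  have hMm : Measurable M := measurable_cellMax hπ href μ _ n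
  have hGm : Measurable (cellMax μ π g n) := measurable_cellMax hπ href μ _ n
  -- Hölder with exponents `q`, `s` on a cell: the Morrey condition takes care of the factor with
  -- `β`, and the factor with `f` is below the running maximum of the averages of `f^s`.
  have h1 := lintegral_mul_sum_cellAvg_le (g := g) hπ href hfin hc (hβ.mul hf)
    (H := fun x => θ * M x ^ (1 / s)) ((hMm.pow_const _).const_mul θ) n (by
      intro j hj
      refine Filter.Eventually.of_forall fun x => ?_
      calc _ ≤ c j * (cellAvg μ (π j) (fun y => β y ^ q) x ^ (1 / q) *
            cellAvg μ (π j) (fun y => f y ^ s) x ^ (1 / s)) := by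
            gcongr
            exact cellAvg_mul_le hqs hβ hf x
        _ ≤ _ := by
            rw [← mul_assoc]
            gcongr
            · exact hθ j x
            · exact cellAvg_le_cellMax μ π _ hj x)
  refine h1.trans ?_
  have hD1 := lintegral_cellMax_rpow_le hpr hπ href hfin hg n
  -- Doob for `f^s` in the exponent `t = r/s`; this needs `t > 1`, which reflects `q > p`.
  have hD2 := lintegral_cellMax_rpow_le ht hπ href hfin (hf.pow_const s) n
  simp only [← ENNReal.rpow_mul, mul_comm s t, hts] at hD2
  have e1 : 1 / s * r = t := by rw [← hts]; field_simp
  have e2 : 1 / t * (1 / s) = 1 / r := by rw [← hts]; field_simp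
  have hD3 : (∫⁻ x, (M x ^ (1 / s)) ^ r ∂μ) ^ (1 / r) ≤
      ENNReal.ofReal t' ^ (1 / s) * (∫⁻ x, f x ^ r ∂μ) ^ (1 / r) := by
    simp only [← ENNReal.rpow_mul, e1]
    rw [← e2, ENNReal.rpow_mul, ENNReal.rpow_mul,
      ← ENNReal.mul_rpow_of_nonneg _ _ (by positivity)]
    exact ENNReal.rpow_le_rpow hD2 (by positivity)
  have hH := ENNReal.lintegral_mul_le_Lp_mul_Lq μ hpr.symm (hMm.pow_const (1 / s)).aemeasurable
    hGm.aemeasurable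
  calc C * ∫⁻ x, θ * M x ^ (1 / s) * cellMax μ π g n x ∂μ
      = C * (θ * ∫⁻ x, ((fun x => M x ^ (1 / s)) * cellMax μ π g n) x ∂μ) := by
        simp only [mul_assoc, Pi.mul_apply]
        rw [lintegral_const_mul _ (by fun_prop)]
    _ ≤ C * (θ * ((ENNReal.ofReal t' ^ (1 / s) * (∫⁻ x, f x ^ r ∂μ) ^ (1 / r)) *
        (ENNReal.ofReal r * (∫⁻ x, g x ^ p ∂μ) ^ (1 / p)))) := by
        gcongr
        exact hH.trans (mul_le_mul' hD3 hD1)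
    _ = _ := by ring

/-- The bilinear estimate under a Morrey condition with exponent `p` and an `A₁` condition. -/
theorem lintegral_mul_sum_cellAvg_le_of_a1 {p r : ℝ} (hpr : p.HolderConjugate r)
    (hπ : ∀ k, Measurable (π k)) (href : ∀ k, Function.FactorsThrough (π k) (π (k + 1)))
    (hfin : ∀ k x, μ (π k ⁻¹' {π k x}) ≠ ⊤)
    (hc : ∀ j n, ∑ k ∈ Finset.Ico j n, c k ≤ C * c j) (hc0 : ∀ k, c k ≠ 0)
    (hβ : Measurable β) (hβfin : ∀ x, β x ≠ ⊤) (hθfin : θ ≠ ⊤)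
    (hθ : ∀ k x, c k * cellAvg μ (π k) (fun y => β y ^ p) x ^ (1 / p) ≤ θ) {K : ℝ≥0∞}
    (hK : ∀ k, ∀ᵐ x ∂μ, cellAvg μ (π k) (fun y => β y ^ p) x ≤ K * β x ^ p)
    (hf : Measurable f) (hg : Measurable g) (n : ℕ) :
    ∫⁻ x, β x * f x * ∑ k ∈ Finset.range (n + 1), c k * cellAvg μ (π k) g x ∂μ ≤
      C * (ENNReal.ofReal r * ENNReal.ofReal p * K ^ (1 / r)) * θ *
        (∫⁻ x, f x ^ r ∂μ) ^ (1 / r) * (∫⁻ x, g x ^ p ∂μ) ^ (1 / p) := by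
  have hp := hpr.pos
  have hr := hpr.symm.pos
  set W : X → ℝ≥0∞ := fun y => β y ^ p with hWdef
  have hW : Measurable W := hβ.pow_const p
  set ν := μ.withDensity W with hν
  -- Chosen so that `h dν = β f dμ`, while the `L_r(ν)` norm of `h` is at most the `L_r(μ)` norm of
  -- `f`, because `p + (1 - p) r = 0`.
  set h : X → ℝ≥0∞ := fun x => f x * β x ^ (1 - p) with hhdef
  have hh : Measurable h := hf.mul (hβ.pow_const _)
  have hcell : ∀ k x, MeasurableSet (π k ⁻¹' {π k x}) := fun k x =>
    hπ k (measurableSet_singleton _)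
  have hνcell : ∀ k x, ν (π k ⁻¹' {π k x}) = ∫⁻ y in π k ⁻¹' {π k x}, W y ∂μ := fun k x =>
    withDensity_apply _ (hcell k x)
  -- A cell of infinite `ν`-mass would violate the Morrey bound, as `c k ≠ 0`.
  have hνfin : ∀ k x, ν (π k ⁻¹' {π k x}) ≠ ⊤ := by
    intro k x hx
    rw [hνcell] at hx
    have h1 := hθ k x
    rw [cellAvg, hx, ENNReal.top_div_of_ne_top (hfin k x),
      ENNReal.top_rpow_of_pos (by positivity), ENNReal.mul_top (hc0 k)] at h1
    exact hθfin (top_le_iff.1 h1)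
  have hWh : ∀ x, W x * h x = β x * f x := by
    intro x
    rcases eq_or_ne (β x) 0 with h0 | h0
    · simp [hWdef, h0, hp]
    · simp only [hWdef, hhdef]
      rw [mul_left_comm, ← ENNReal.rpow_add _ _ h0 (hβfin x)]
      simp [mul_comm]
  have hWhr : ∀ x, W x * h x ^ r ≤ f x ^ r := by
    intro x
    rcases eq_or_ne (β x) 0 with h0 | h0
    · simp [hWdef, h0, hp]
    · simp only [hWdef, hhdef]
      rw [ENNReal.mul_rpow_of_nonneg _ _ hr.le, mul_left_comm, ← ENNReal.rpow_mul,
        ← ENNReal.rpow_add _ _ h0 (hβfin x)]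
      have : p + (1 - p) * r = 0 := by
        have := hpr.sub_one_mul_conj
        linarith
      simp [this]
  have havg : ∀ k x, cellAvg μ (π k) (fun y => β y * f y) x =
      cellAvg μ (π k) W x * cellAvg ν (π k) h x := by
    intro k x
    simp only [cellAvg]
    have e : ∫⁻ y in π k ⁻¹' {π k x}, h y ∂ν = ∫⁻ y in π k ⁻¹' {π k x}, β y * f y ∂μ := by
      rw [hν, setLIntegral_withDensity_eq_setLIntegral_mul μ hW hh (hcell k x)]
      simp only [Pi.mul_apply, hWh]
    rw [e, hνcell]
    set I := ∫⁻ y in π k ⁻¹' {π k x}, W y ∂μ with hI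
    rcases eq_or_ne I 0 with h0 | h0
    · have hz : ∫⁻ y in π k ⁻¹' {π k x}, β y * f y ∂μ = 0 := by
        rw [← e]
        refine setLIntegral_measure_zero _ _ ?_
        rw [hνcell, ← hI, h0]
      simp [h0, hz]
    · have h1 : I ≠ ⊤ := by
        rw [hI, ← hνcell k x]; exact hνfin k x
      rw [div_eq_mul_inv I, mul_right_comm, ENNReal.mul_div_cancel h0 h1, div_eq_mul_inv]
  set M := cellMax ν π h n
  have hMm : Measurable M := measurable_cellMax hπ href ν _ n
  have hGm : Measurable (cellMax μ π g n) := measurable_cellMax hπ href μ _ n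
  have hs : 1 / p + 1 / r = 1 := by simpa using hpr.inv_add_inv_eq_one
  -- The average of `W` is split into its powers `1/p` and `1/r`: with `c j` the first is at most
  -- `θ`, and the A₁ condition bounds the second by `(K W)^{1/r}`, the density factor that turns the
  -- `L_r(μ)` norm back into the `L_r(ν)` norm of `M`.
  have h1 := lintegral_mul_sum_cellAvg_le (g := g) hπ href hfin hc (hβ.mul hf)
    (H := fun x => θ * K ^ (1 / r) * (W x ^ (1 / r) * M x))
    (((hW.pow_const _).mul hMm).const_mul _) n (by
      intro j hj
      filter_upwards [hK j] with x hx
      have e : cellAvg μ (π j) W x =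
          cellAvg μ (π j) W x ^ (1 / p) * cellAvg μ (π j) W x ^ (1 / r) := by
        rw [← ENNReal.rpow_add_of_nonneg _ _ (by positivity) (by positivity), hs,
          ENNReal.rpow_one]
      calc _ = c j * (cellAvg μ (π j) W x * cellAvg ν (π j) h x) := by
            rw [← havg]; rfl
        _ = (c j * cellAvg μ (π j) W x ^ (1 / p)) * cellAvg μ (π j) W x ^ (1 / r) *
            cellAvg ν (π j) h x := by
            nth_rw 1 [e]; ring
        _ ≤ θ * (K * W x) ^ (1 / r) * M x := by
            gcongr
            · exact hθ j x
            · exact cellAvg_le_cellMax ν π _ hj x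
        _ = _ := by rw [ENNReal.mul_rpow_of_nonneg _ _ (by positivity)]; ring)
  refine h1.trans ?_
  have hD1 := lintegral_cellMax_rpow_le hpr hπ href hfin hg n
  have hD2 := lintegral_cellMax_rpow_le hpr.symm hπ href hνfin hh n
  have hD3 : (∫⁻ x, (W x ^ (1 / r) * M x) ^ r ∂μ) ^ (1 / r) ≤
      ENNReal.ofReal p * (∫⁻ x, f x ^ r ∂μ) ^ (1 / r) := by
    have e : ∀ k : X → ℝ≥0∞, Measurable k → ∫⁻ x, k x ^ r ∂ν = ∫⁻ x, W x * k x ^ r ∂μ := by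
      intro k hk
      rw [hν, lintegral_withDensity_eq_lintegral_mul μ hW (hk.pow_const r)]
      rfl
    rw [e _ hMm, e _ hh] at hD2
    have e2 : ∀ x, (W x ^ (1 / r) * M x) ^ r = W x * M x ^ r := by
      intro x
      rw [ENNReal.mul_rpow_of_nonneg _ _ hr.le, ← ENNReal.rpow_mul, one_div_mul_cancel hr.ne',
        ENNReal.rpow_one]
    simp only [e2]
    refine hD2.trans ?_
    gcongr
    exact hWhr _
  have hH := ENNReal.lintegral_mul_le_Lp_mul_Lq μ hpr.symm
    ((hW.pow_const (1 / r)).mul hMm).aemeasurable hGm.aemeasurable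
  calc C * ∫⁻ x, θ * K ^ (1 / r) * (W x ^ (1 / r) * M x) * cellMax μ π g n x ∂μ
      = C * (θ * K ^ (1 / r) *
          ∫⁻ x, ((fun x => W x ^ (1 / r) * M x) * cellMax μ π g n) x ∂μ) := by
        have hm : Measurable ((fun x => W x ^ (1 / r) * M x) * cellMax μ π g n) :=
          ((hW.pow_const _).mul hMm).mul hGm
        rw [← lintegral_const_mul _ hm]
        simp only [mul_assoc, Pi.mul_apply]
    _ ≤ C * (θ * K ^ (1 / r) * ((ENNReal.ofReal p * (∫⁻ x, f x ^ r ∂μ) ^ (1 / r)) *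
        (ENNReal.ofReal r * (∫⁻ x, g x ^ p ∂μ) ^ (1 / p)))) := by
        gcongr
        exact hH.trans (mul_le_mul' hD3 hD1)
    _ = _ := by ring

/-- The bilinear estimate under a subcritical integrability condition. -/
theorem lintegral_mul_sum_cellAvg_le_of_subcritical {p r q : ℝ} (hpr : p.HolderConjugate r)
    (hpq : p ≤ q) (hπ : ∀ k, Measurable (π k))
    (hfin : ∀ k x, μ (π k ⁻¹' {π k x}) ≠ ⊤) {ε : ℕ → ℝ≥0∞}
    (hε : ∀ n, ∑ k ∈ Finset.range n, ε k ≤ C) (hβ : Measurable β)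
    (hθ : ∀ k x, c k * cellAvg μ (π k) (fun y => β y ^ q) x ^ (1 / q) ≤ θ * ε k)
    (hf : Measurable f) (hg : Measurable g) (n : ℕ) :
    ∫⁻ x, β x * f x * ∑ k ∈ Finset.range (n + 1), c k * cellAvg μ (π k) g x ∂μ ≤
      C * θ * (∫⁻ x, f x ^ r ∂μ) ^ (1 / r) * (∫⁻ x, g x ^ p ∂μ) ^ (1 / p) := by
  have hp := hpr.pos
  have hr := hpr.symm.pos
  have hq : 0 < q := hp.trans_le hpq
  have hAm : ∀ k, Measurable (cellAvg μ (π k) g) := fun k => measurable_cellAvg μ (hπ k) g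
  -- Each level is estimated alone: the average of `g` is constant on cells, so `β^p` may be
  -- averaged and Jensen raises `p` to `q`. No maximal function is needed since the `ε k` are
  -- summable.
  have key : ∀ k, (∫⁻ x, (β x * (c k * cellAvg μ (π k) g x)) ^ p ∂μ) ^ (1 / p) ≤
      θ * ε k * (∫⁻ x, g x ^ p ∂μ) ^ (1 / p) := by
    intro k
    rw [one_div, ENNReal.rpow_inv_le_iff hp, ENNReal.mul_rpow_of_nonneg _ _ hp.le,
      ← ENNReal.rpow_mul, inv_mul_cancel₀ hp.ne', ENNReal.rpow_one]
    calc _ = ∫⁻ x, β x ^ p * (c k * cellAvg μ (π k) g x) ^ p ∂μ := by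
          simp only [ENNReal.mul_rpow_of_nonneg _ _ hp.le]
      _ = ∫⁻ x, cellAvg μ (π k) (fun y => β y ^ p) x * (c k * cellAvg μ (π k) g x) ^ p ∂μ := by
          refine (lintegral_cellAvg_mul (hπ k) (hfin k) (hβ.pow_const p) ?_).symm
          intro x y hxy
          simp only [cellAvg_factorsThrough μ (π k) g hxy]
      _ ≤ ∫⁻ x, (θ * ε k) ^ p * cellAvg μ (π k) g x ^ p ∂μ := by
          refine lintegral_mono fun x => ?_
          have hJ := cellAvg_rpow_le (μ := μ) (π := π k) ((one_le_div hp).2 hpq)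
            (hβ.pow_const p) x
          simp only [← ENNReal.rpow_mul, mul_div_cancel₀ q hp.ne'] at hJ
          have hJ2 : cellAvg μ (π k) (fun y => β y ^ p) x ≤
              (cellAvg μ (π k) (fun y => β y ^ q) x ^ (1 / q)) ^ p := by
            rw [← ENNReal.rpow_mul, one_div_mul_eq_div, ← inv_div]
            exact (ENNReal.le_rpow_inv_iff (by positivity)).2 hJ
          calc _ ≤ (cellAvg μ (π k) (fun y => β y ^ q) x ^ (1 / q)) ^ p *
                (c k * cellAvg μ (π k) g x) ^ p := by gcongr
            _ = (c k * cellAvg μ (π k) (fun y => β y ^ q) x ^ (1 / q)) ^ p *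
                cellAvg μ (π k) g x ^ p := by
                simp only [ENNReal.mul_rpow_of_nonneg _ _ hp.le]; ring
            _ ≤ _ := mul_le_mul_left (ENNReal.rpow_le_rpow (hθ k x) hp.le) _
      _ = (θ * ε k) ^ p * ∫⁻ x, cellAvg μ (π k) g x ^ p ∂μ :=
          lintegral_const_mul _ ((hAm k).pow_const p)
      _ ≤ _ := by
          gcongr (θ * ε k) ^ p * ?_
          exact lintegral_cellAvg_rpow_le (hπ k) (hfin k) hpr.lt.le hg
  calc _ = ∑ k ∈ Finset.range (n + 1),
        ∫⁻ x, (f * fun x => β x * (c k * cellAvg μ (π k) g x)) x ∂μ := by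
        have hm : ∀ k ∈ Finset.range (n + 1), Measurable
            (f * fun x => β x * (c k * cellAvg μ (π k) g x)) := fun k _ =>
          hf.mul (hβ.mul ((hAm k).const_mul (c k)))
        rw [← lintegral_finsetSum _ hm]
        refine lintegral_congr fun x => ?_
        rw [Finset.mul_sum]
        refine Finset.sum_congr rfl fun k _ => ?_
        simp only [Pi.mul_apply]
        ring
    _ ≤ ∑ k ∈ Finset.range (n + 1), (∫⁻ x, f x ^ r ∂μ) ^ (1 / r) *
          (θ * ε k * (∫⁻ x, g x ^ p ∂μ) ^ (1 / p)) := by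
        refine Finset.sum_le_sum fun k _ => ?_
        refine (ENNReal.lintegral_mul_le_Lp_mul_Lq μ hpr.symm hf.aemeasurable
          (hβ.mul ((hAm k).const_mul (c k))).aemeasurable).trans ?_
        gcongr
        exact key k
    _ = (∑ k ∈ Finset.range (n + 1), ε k) * θ * (∫⁻ x, f x ^ r ∂μ) ^ (1 / r) *
          (∫⁻ x, g x ^ p ∂μ) ^ (1 / p) := by
        simp only [Finset.sum_mul]
        exact Finset.sum_congr rfl fun k _ => by ring
    _ ≤ _ := by gcongr; exact hε _

end Bilinear

/-! ### Nested cubic grids, the one-third trick and the dyadic Riesz potential. -/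

section Grid

variable {d : ℕ}

/-- The index of the cell containing `x` in the grid of cubes of side `ℓ` shifted by `s`. -/
noncomputable def gridIndex (s : Fin d → ℝ) (ℓ : ℝ) (x : EuclideanSpace ℝ (Fin d)) : Fin d → ℤ :=
  fun i => ⌊(x i - s i) / ℓ⌋

lemma measurable_gridIndex (s : Fin d → ℝ) (ℓ : ℝ) : Measurable (gridIndex s ℓ) := by
  refine measurable_pi_iff.2 fun i => Int.measurable_floor.comp ?_
  fun_prop

lemma floor_eq_of_floor_two_mul_eq {a b : ℝ} (h : ⌊2 * a⌋ = ⌊2 * b⌋) : ⌊a⌋ = ⌊b⌋ := by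
  have key : ∀ t : ℝ, 2 * ⌊t⌋ ≤ ⌊2 * t⌋ ∧ ⌊2 * t⌋ < 2 * ⌊t⌋ + 2 := by
    intro t
    refine ⟨Int.le_floor.2 ?_, Int.floor_lt.2 ?_⟩
    · push_cast; linarith [Int.floor_le t]
    · push_cast; linarith [Int.lt_floor_add_one t]
  have h1 := key a
  have h2 := key b
  omega

lemma gridIndex_factorsThrough (s : Fin d → ℝ) (L : ℝ) (k : ℕ) :
    Function.FactorsThrough (gridIndex s (L / 2 ^ k)) (gridIndex s (L / 2 ^ (k + 1))) := by
  intro x y hxy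
  funext i
  have h := congrFun hxy i
  refine floor_eq_of_floor_two_mul_eq ?_
  have e : ∀ t : ℝ, 2 * (t / (L / 2 ^ k)) = t / (L / 2 ^ (k + 1)) := by
    intro t
    rw [div_div_eq_mul_div, div_div_eq_mul_div, pow_succ]
    ring
  rw [e, e]
  exact h

lemma gridIndex_preimage (s : Fin d → ℝ) {ℓ : ℝ} (hℓ : 0 < ℓ) (m : Fin d → ℤ) :
    gridIndex s ℓ ⁻¹' {m} = (WithLp.ofLp : EuclideanSpace ℝ (Fin d) → Fin d → ℝ) ⁻¹'
      (Set.univ.pi fun i => Set.Ico (s i + m i * ℓ) (s i + (m i + 1) * ℓ)) := by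
  ext y
  simp only [Set.mem_preimage, Set.mem_singleton_iff, Set.mem_univ_pi, Set.mem_Ico, funext_iff,
    gridIndex, Int.floor_eq_iff, le_div_iff₀ hℓ, div_lt_iff₀ hℓ]
  refine forall_congr' fun i => ?_
  constructor <;> rintro ⟨h1, h2⟩ <;> constructor <;> linarith

lemma volume_gridIndex_preimage (s : Fin d → ℝ) {ℓ : ℝ} (hℓ : 0 < ℓ) (m : Fin d → ℤ) :
    volume (gridIndex s ℓ ⁻¹' {m}) = ENNReal.ofReal ℓ ^ d := by
  rw [gridIndex_preimage s hℓ, (PiLp.volume_preserving_ofLp (Fin d)).measure_preimage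
    (MeasurableSet.univ_pi fun i => measurableSet_Ico).nullMeasurableSet, Real.volume_pi_Ico]
  have : ∀ i, s i + (m i + 1 : ℝ) * ℓ - (s i + m i * ℓ) = ℓ := fun i => by ring
  simp [this]

lemma norm_lt_of_forall_abs_lt (hd : 0 < d) {ℓ : ℝ} {v : EuclideanSpace ℝ (Fin d)}
    (h : ∀ i, |v i| < ℓ) : ‖v‖ < d * ℓ := by
  have hℓ : 0 < ℓ := (abs_nonneg _).trans_lt (h ⟨0, hd⟩)
  have hd1 : (1 : ℝ) ≤ d := by exact_mod_cast hd
  refine lt_of_pow_lt_pow_left₀ 2 (by positivity) ?_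
  rw [EuclideanSpace.real_norm_sq_eq]
  calc ∑ i, v i ^ 2 < ∑ _i : Fin d, ℓ ^ 2 := by
        refine Finset.sum_lt_sum_of_nonempty ⟨⟨0, hd⟩, Finset.mem_univ _⟩ fun i _ => ?_
        rw [← sq_abs]
        exact pow_lt_pow_left₀ (h i) (abs_nonneg _) two_ne_zero
    _ = d * ℓ ^ 2 := by simp
    _ ≤ (d * ℓ) ^ 2 := by nlinarith [sq_nonneg ℓ]

lemma gridIndex_preimage_subset_ball (hd : 0 < d) (s : Fin d → ℝ) {ℓ : ℝ} (hℓ : 0 < ℓ)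
    (x : EuclideanSpace ℝ (Fin d)) :
    gridIndex s ℓ ⁻¹' {gridIndex s ℓ x} ⊆ Metric.ball x (d * ℓ) := by
  intro y hy
  rw [mem_ball_iff_norm]
  refine norm_lt_of_forall_abs_lt hd fun i => ?_
  have h := Int.abs_sub_lt_one_of_floor_eq_floor (congrFun (show gridIndex s ℓ y = _ from hy) i)
  rw [← sub_div, sub_sub_sub_cancel_right, abs_div, abs_of_pos hℓ, div_lt_one hℓ] at h
  simpa using h

/-- The cell lies in the ball of radius `d ℓ` about any of its points, and the volume ratio of the
two is that of the ball of radius `d` to the unit cube. -/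
lemma cellAvg_gridIndex_le_laverage (hd : 0 < d) (s : Fin d → ℝ) {ℓ : ℝ} (hℓ : 0 < ℓ)
    (w : EuclideanSpace ℝ (Fin d) → ℝ≥0∞) (x : EuclideanSpace ℝ (Fin d)) :
    cellAvg volume (gridIndex s ℓ) w x ≤
      volume (Metric.ball (0 : EuclideanSpace ℝ (Fin d)) d) *
        ⨍⁻ y in Metric.ball x (d * ℓ), w y ∂volume := by
  have hd' : (0 : ℝ) < d := by exact_mod_cast hd
  set V := volume (Metric.ball (0 : EuclideanSpace ℝ (Fin d)) d) with hV
  have hV0 : V ≠ 0 := (Metric.measure_ball_pos _ _ hd').ne'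
  have hVt : V ≠ ⊤ := measure_ball_lt_top.ne
  rw [setLAverage_eq, cellAvg, volume_gridIndex_preimage s hℓ, mul_comm (d : ℝ) ℓ,
    Measure.addHaar_ball_mul_of_pos _ _ hℓ, ← hV, finrank_euclideanSpace_fin, ENNReal.ofReal_pow hℓ.le,
    mul_comm _ V, ← mul_div_assoc, ENNReal.mul_div_mul_left _ _ hV0 hVt]
  gcongr
  rw [mul_comm]
  exact gridIndex_preimage_subset_ball hd s hℓ x

lemma floor_eq_of_forall_int_not_mem {x y ε : ℝ} (hy : |y - x| < ε)
    (h : ∀ n : ℤ, ε ≤ |(n : ℝ) - x|) : ⌊y⌋ = ⌊x⌋ := by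
  rw [abs_lt] at hy
  rw [Int.floor_eq_iff]
  have h1 := h ⌊x⌋
  have h2 := h (⌊x⌋ + 1)
  have h3 := Int.floor_le x
  have h4 := Int.lt_floor_add_one x
  push_cast at h2
  rw [abs_of_nonpos (by linarith)] at h1
  rw [abs_of_pos (by linarith)] at h2
  constructor <;> linarith

/-- The one-third trick on the line. -/
lemma floor_const_or_floor_const (x : ℝ) (k : ℕ) :
    (∀ y, |y - x| < 1 / 6 → ⌊y⌋ = ⌊x⌋) ∨
      ∀ y, |y - x| < 1 / 6 → ⌊y - 2 ^ k / 3⌋ = ⌊x - 2 ^ k / 3⌋ := by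
  by_cases h : ∀ n : ℤ, 1 / 6 ≤ |(n : ℝ) - x|
  · exact Or.inl fun y hy => floor_eq_of_forall_int_not_mem hy h
  · push Not at h
    obtain ⟨n, hn⟩ := h
    refine Or.inr fun y hy => floor_eq_of_forall_int_not_mem (ε := 1 / 6) (by simpa using hy) ?_
    intro m
    by_contra! hm
    rw [abs_lt] at hn hm
    -- If both grids had a point within `1/6`, the integer `3 (n - m)` would differ from `2^k` by
    -- less than `1`, so `3` would divide `2^k`.
    have h1 : (3 * (n - m) : ℝ) < 2 ^ k + 1 := by linarith
    have h2 : (2 ^ k : ℝ) - 1 < 3 * (n - m) := by linarith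
    have h1' : 3 * (n - m) < 2 ^ k + 1 := by exact_mod_cast h1
    have h2' : 2 ^ k - 1 < 3 * (n - m) := by exact_mod_cast h2
    have h3 : (3 : ℤ) ∣ 2 ^ k := ⟨n - m, by omega⟩
    have h4 : (3 : ℤ) ∣ 2 := Int.Prime.dvd_pow' (by norm_num) h3
    omega

/-- The shifts of the grids in the one-third trick. -/
def gridShift (ρ : ℝ) (e : Fin d → Bool) (i : Fin d) : ℝ := if e i then 2 * ρ else 0

/-- The one-third trick in each coordinate. The radius is one sixth of the side, and the shift `2ρ`
measures `2^k / 3` sides at level `k`. The shift does not depend on `k`, so each of the `2^d` grids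
stays nested. -/
lemma exists_ball_subset_cell {ρ : ℝ} (hρ : 0 < ρ) (k : ℕ) (x : EuclideanSpace ℝ (Fin d)) :
    ∃ e : Fin d → Bool, Metric.ball x (ρ / 2 ^ k) ⊆
      gridIndex (gridShift ρ e) (6 * ρ / 2 ^ k) ⁻¹'
        {gridIndex (gridShift ρ e) (6 * ρ / 2 ^ k) x} := by
  set ℓ := 6 * ρ / 2 ^ k with hℓdef
  have hℓ : 0 < ℓ := by positivity
  have h2k : (2 : ℝ) ^ k ≠ 0 := by positivity
  have key : ∀ i, ∃ b : Bool, ∀ y, |y - x i| < ρ / 2 ^ k →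
      ⌊(y - if b then 2 * ρ else 0) / ℓ⌋ = ⌊(x i - if b then 2 * ρ else 0) / ℓ⌋ := by
    intro i
    have hs : ∀ y, |y - x i| < ρ / 2 ^ k → |y / ℓ - x i / ℓ| < 1 / 6 := by
      intro y hy
      rw [← sub_div, abs_div, abs_of_pos hℓ, div_lt_iff₀ hℓ]
      have e1 : 1 / 6 * ℓ = ρ / 2 ^ k := by rw [hℓdef]; ring
      rwa [e1]
    have e2 : 2 * ρ / ℓ = 2 ^ k / 3 := by
      rw [hℓdef]; field_simp; norm_num
    rcases floor_const_or_floor_const (x i / ℓ) k with h | h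
    · exact ⟨false, fun y hy => by simpa using h _ (hs y hy)⟩
    · exact ⟨true, fun y hy => by simpa [sub_div, e2] using h _ (hs y hy)⟩
  choose e he using key
  refine ⟨e, fun y hy => funext fun i => he i _ ?_⟩
  rw [mem_ball_iff_norm] at hy
  exact (by simpa using PiLp.norm_apply_le (y - x) i : |y i - x i| ≤ ‖y - x‖).trans_lt hy

/-- The dyadic form of the Riesz potential of order `α`, truncated at the scale `ρ`. -/
noncomputable def rieszSum (α : ℕ) (ρ : ℝ) (g : EuclideanSpace ℝ (Fin d) → ℝ≥0∞)
    (x : EuclideanSpace ℝ (Fin d)) : ℝ≥0∞ :=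
  ∑' k : ℕ, ENNReal.ofReal (ρ / 2 ^ k) ^ α *
    ((∫⁻ y in Metric.ball x (ρ / 2 ^ k), g y) / ENNReal.ofReal (ρ / 2 ^ k) ^ d)

/-- The `k`-th partition of the grid adapted to the truncated potential `rieszSum α ρ`. -/
noncomputable def dyadicGrid (s : Fin d → ℝ) (ρ : ℝ) (k : ℕ) :
    EuclideanSpace ℝ (Fin d) → Fin d → ℤ :=
  gridIndex s (6 * ρ / 2 ^ k)

lemma volume_dyadicGrid_ne_top (s : Fin d → ℝ) {ρ : ℝ} (hρ : 0 < ρ) (k : ℕ)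
    (x : EuclideanSpace ℝ (Fin d)) :
    volume (dyadicGrid s ρ k ⁻¹' {dyadicGrid s ρ k x}) ≠ ⊤ := by
  rw [dyadicGrid, volume_gridIndex_preimage s (by positivity)]
  exact ENNReal.pow_ne_top ENNReal.ofReal_ne_top

/-- The good grid depends on `x` and `k`, hence the sum over all of them; `6^d` is the volume of a
cell in units of the radius. -/
lemma rieszSum_le (α : ℕ) {ρ : ℝ} (hρ : 0 < ρ) (g : EuclideanSpace ℝ (Fin d) → ℝ≥0∞)
    (x : EuclideanSpace ℝ (Fin d)) :
    rieszSum α ρ g x ≤ 6 ^ d * ∑ e : Fin d → Bool, ∑' k : ℕ, ENNReal.ofReal (ρ / 2 ^ k) ^ α *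
      cellAvg volume (dyadicGrid (gridShift ρ e) ρ k) g x := by
  have h6 : ENNReal.ofReal 6 = 6 := by simp
  calc rieszSum α ρ g x ≤ ∑' k : ℕ, ∑ e : Fin d → Bool, 6 ^ d * (ENNReal.ofReal (ρ / 2 ^ k) ^ α *
        cellAvg volume (dyadicGrid (gridShift ρ e) ρ k) g x) := by
        refine ENNReal.tsum_le_tsum fun k => ?_
        obtain ⟨e, he⟩ := exists_ball_subset_cell hρ k x
        refine le_trans ?_ (Finset.single_le_sum (fun _ _ => zero_le) (Finset.mem_univ e))
        rw [mul_left_comm]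
        gcongr
        have hv : ENNReal.ofReal (6 * ρ / 2 ^ k) ^ d = 6 ^ d * ENNReal.ofReal (ρ / 2 ^ k) ^ d := by
          rw [mul_div_assoc, ENNReal.ofReal_mul (by norm_num), h6, mul_pow]
        rw [cellAvg, dyadicGrid, volume_gridIndex_preimage _ (by positivity), hv,
          ← mul_div_assoc, ENNReal.mul_div_mul_left _ _ (by simp) (by simp)]
        gcongr
    _ = _ := by
        rw [Finset.mul_sum, Summable.tsum_finsetSum fun _ _ => ENNReal.summable]
        simp only [ENNReal.tsum_mul_left]

lemma sum_ofReal_div_two_pow_le {α : ℕ} (hα : α ≠ 0) {ρ : ℝ} (hρ : 0 < ρ) (j n : ℕ) :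
    ∑ k ∈ Finset.Ico j n, ENNReal.ofReal (ρ / 2 ^ k) ^ α ≤ 2 * ENNReal.ofReal (ρ / 2 ^ j) ^ α := by
  have hstep : ∀ k : ℕ, 2 * ENNReal.ofReal (ρ / 2 ^ (k + 1)) ^ α ≤
      ENNReal.ofReal (ρ / 2 ^ k) ^ α := by
    intro k
    have e : ρ / 2 ^ k = 2 * (ρ / 2 ^ (k + 1)) := by rw [pow_succ]; field_simp
    rw [e, ENNReal.ofReal_mul (by norm_num), mul_pow]
    gcongr
    simpa using le_self_pow₀ (one_le_two : (1 : ℝ≥0∞) ≤ 2) hα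
  rcases lt_or_ge n j with h | h
  · simp [Finset.Ico_eq_empty_of_le h.le]
  -- The claim is strengthened by the tail `2 c_n`, which makes the induction close.
  refine le_trans ?_ (?_ : ∑ k ∈ Finset.Ico j n, ENNReal.ofReal (ρ / 2 ^ k) ^ α +
    2 * ENNReal.ofReal (ρ / 2 ^ n) ^ α ≤ _)
  · exact le_self_add
  induction n, h using Nat.le_induction with
  | base => simp
  | succ n hn ih =>
    refine le_trans ?_ ih
    rw [Finset.sum_Ico_succ_top hn, add_assoc, two_mul (ENNReal.ofReal (ρ / 2 ^ n) ^ α)]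
    gcongr
    exact hstep n

/-- Bilinear dyadic estimates imply an `L_p` estimate of a weighted truncated potential. -/
theorem lintegral_mul_rieszSum_le {p r : ℝ} (hpr : p.HolderConjugate r) (α : ℕ) {ρ : ℝ}
    (hρ : 0 < ρ) {β : EuclideanSpace ℝ (Fin d) → ℝ≥0∞} (hβ : Measurable β) {B : ℝ≥0∞}
    {g : EuclideanSpace ℝ (Fin d) → ℝ≥0∞}
    (hB : ∀ (s : Fin d → ℝ) (f : EuclideanSpace ℝ (Fin d) → ℝ≥0∞) (n : ℕ), Measurable f →
      ∫⁻ x, β x * f x * ∑ k ∈ Finset.range (n + 1), ENNReal.ofReal (ρ / 2 ^ k) ^ α *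
        cellAvg volume (dyadicGrid s ρ k) g x ≤
      B * (∫⁻ x, f x ^ r) ^ (1 / r) * (∫⁻ x, g x ^ p) ^ (1 / p)) :
    (∫⁻ x, (β x * rieszSum α ρ g x) ^ p) ^ (1 / p) ≤
      12 ^ d * B * (∫⁻ x, g x ^ p) ^ (1 / p) := by
  have hp := hpr.pos
  have hAm : ∀ (s : Fin d → ℝ) (k : ℕ), Measurable fun x => ENNReal.ofReal (ρ / 2 ^ k) ^ α *
      cellAvg volume (dyadicGrid s ρ k) g x := fun s k =>
    (measurable_cellAvg volume (measurable_gridIndex s _) g).const_mul _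
  set T : (Fin d → Bool) → EuclideanSpace ℝ (Fin d) → ℝ≥0∞ := fun e x =>
    ∑' k : ℕ, ENNReal.ofReal (ρ / 2 ^ k) ^ α *
      cellAvg volume (dyadicGrid (gridShift ρ e) ρ k) g x with hT
  have hTm : ∀ e, Measurable (T e) := fun e => Measurable.tsum (hAm _)
  have hTf : ∀ e (f : EuclideanSpace ℝ (Fin d) → ℝ≥0∞), Measurable f →
      ∫⁻ x, β x * f x * T e x ≤ B * (∫⁻ x, f x ^ r) ^ (1 / r) * (∫⁻ x, g x ^ p) ^ (1 / p) := by
    intro e f hf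
    simp only [hT, ← ENNReal.tsum_mul_left]
    have hm : ∀ k, Measurable fun x => β x * f x *
      (ENNReal.ofReal (ρ / 2 ^ k) ^ α * cellAvg volume (dyadicGrid (gridShift ρ e) ρ k) g x) :=
        fun k => (hβ.mul hf).mul (hAm _ k)
    rw [lintegral_tsum fun k => (hm k).aemeasurable]
    refine ENNReal.tsum_le_of_sum_range_le fun n => ?_
    rw [← lintegral_finsetSum _ fun k _ => hm k]
    refine le_trans (lintegral_mono fun x => ?_) (hB (gridShift ρ e) f n hf)
    simp only [← Finset.mul_sum]
    gcongr
    exact n.le_succ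
  calc _ ≤ (∫⁻ x, (β x * (6 ^ d * ∑ e, T e x)) ^ p) ^ (1 / p) := by
        gcongr with x
        exact rieszSum_le α hρ g x
    _ ≤ _ := by
        refine lintegral_rpow_le_of_forall_dual hpr
          (hβ.mul ((Finset.measurable_fun_sum _ fun e _ => hTm e).const_mul _)) fun f hf => ?_
        calc _ = 6 ^ d * ∑ e, ∫⁻ x, β x * f x * T e x := by
              have hm : ∀ e ∈ Finset.univ, Measurable fun x => β x * f x * T e x :=
                fun e _ => (hβ.mul hf).mul (hTm e)
              rw [← lintegral_finsetSum _ hm,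
                ← lintegral_const_mul _ (Finset.measurable_fun_sum _ hm)]
              refine lintegral_congr fun x => ?_
              simp only [Pi.mul_apply, ← Finset.mul_sum]
              ring
          _ ≤ 6 ^ d * ∑ _e : Fin d → Bool,
                B * (∫⁻ x, f x ^ r) ^ (1 / r) * (∫⁻ x, g x ^ p) ^ (1 / p) := by
              gcongr with e
              exact hTf e f hf
          _ = _ := by
              have h12 : (12 : ℝ≥0∞) = 6 * 2 := by norm_num
              simp only [Finset.sum_const, Finset.card_univ, Fintype.card_fun, Fintype.card_bool,
                Fintype.card_fin, nsmul_eq_mul, h12, mul_pow]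
              push_cast
              ring

end Grid

/-! ### First and second order Taylor bounds along segments. -/

section Segments

variable {E F : Type*} [NormedAddCommGroup E] [NormedSpace ℝ E] [NormedAddCommGroup F]
  [NormedSpace ℝ F]

lemma hasDerivAt_comp_segment {v : E → F} {x w : E} {t : ℝ}
    (hv : DifferentiableAt ℝ v (x + t • w)) :
    HasDerivAt (fun t : ℝ => v (x + t • w)) (fderiv ℝ v (x + t • w) w) t := by
  have h1 : HasDerivAt (fun t : ℝ => x + t • w) w t := by
    simpa using ((hasDerivAt_id t).smul_const w).const_add x
  exact hv.hasFDerivAt.comp_hasDerivAt t h1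

lemma enorm_le_add_lintegral_fderiv {v : E → F} (hv : ContDiff ℝ 1 v) (x y : E) :
    ‖v x‖ₑ ≤ ‖v y‖ₑ + ∫⁻ t in Set.Ioc (0 : ℝ) 1,
      ‖y - x‖ₑ * ‖fderiv ℝ v (x + t • (y - x))‖ₑ := by
  set h : ℝ → F := fun t => v (x + t • (y - x)) with hh
  have hh1 : ContDiff ℝ 1 h := hv.comp (by fun_prop)
  have h1 := enorm_sub_le_lintegral_deriv_of_contDiffOn_Icc (hh1.contDiffOn (s := Set.Icc 0 1))
    zero_le_one
  rw [← restrict_Ioc_eq_restrict_Icc] at h1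
  have e0 : h 0 = v x := by simp [hh]
  have e1 : h 1 = v y := by simp [hh]
  calc ‖v x‖ₑ = ‖h 1 - (h 1 - h 0)‖ₑ := by rw [e0]; simp
    _ ≤ ‖h 1‖ₑ + ‖h 1 - h 0‖ₑ := enorm_sub_le
    _ ≤ _ := by
        rw [e1] at h1 ⊢
        gcongr
        refine h1.trans (lintegral_mono fun t => ?_)
        rw [(hasDerivAt_comp_segment (hv.differentiable one_ne_zero _)).deriv, mul_comm]
        exact ContinuousLinearMap.le_opENorm _ _

/-- The second difference is an increment of `s ↦ h (s + 1/2) - h s`, hence at most a double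
integral of `|h''(τ)|` over `s ≤ τ ≤ s + 1/2`. For fixed `τ` the admissible `s` have measure at most
`τ`; this weight later produces a potential of order two. -/
lemma enorm_second_difference_le {h : ℝ → F} (hh : ContDiff ℝ 2 h) :
    ‖h 1 - h (1 / 2) - (h (1 / 2) - h 0)‖ₑ ≤
      ∫⁻ t in Set.Ioc (0 : ℝ) 1, ENNReal.ofReal t * ‖deriv (deriv h) t‖ₑ := by
  have hd : ContDiff ℝ 1 (deriv h) := (contDiff_succ_iff_deriv.1
    (show ContDiff ℝ (1 + 1) h by simpa [one_add_one_eq_two] using hh)).2.2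
  have hdd : Continuous (deriv (deriv h)) := hd.continuous_deriv le_rfl
  have hdiff : Differentiable ℝ h := hh.differentiable two_ne_zero
  set k : ℝ → F := fun s => h (s + 1 / 2) - h s with hk
  have hk1 : ContDiff ℝ 1 k := ((hh.of_le one_le_two).comp (by fun_prop)).sub (hh.of_le one_le_two)
  have hkd : ∀ s, deriv k s = deriv h (s + 1 / 2) - deriv h s := by
    intro s
    refine HasDerivAt.deriv (HasDerivAt.sub ?_ (hdiff s).hasDerivAt)
    exact (hdiff _).hasDerivAt.comp_add_const s (1 / 2)
  have h1 := enorm_sub_le_lintegral_deriv_of_contDiffOn_Icc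
    (hk1.contDiffOn (s := Set.Icc 0 (1 / 2))) (by norm_num)
  have e : k (1 / 2) - k 0 = h 1 - h (1 / 2) - (h (1 / 2) - h 0) := by
    simp only [hk]; norm_num
  rw [e] at h1
  set S : Set (ℝ × ℝ) := {z | z.1 ≤ z.2} with hS
  have hSm : MeasurableSet S := measurableSet_le measurable_fst measurable_snd
  set Φ : ℝ → ℝ → ℝ≥0∞ := fun s τ => S.indicator 1 (s, τ) * ‖deriv (deriv h) τ‖ₑ with hΦ
  have hΦm : Measurable (Function.uncurry Φ) :=
    (measurable_one.indicator hSm).mul (hdd.enorm.measurable.comp measurable_snd)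
  calc _ ≤ ∫⁻ s in Set.Icc (0 : ℝ) (1 / 2), ‖deriv k s‖ₑ := h1
    _ ≤ ∫⁻ s in Set.Icc (0 : ℝ) (1 / 2), ∫⁻ τ in Set.Icc (0 : ℝ) 1, Φ s τ := by
        refine setLIntegral_mono' measurableSet_Icc fun s hs => ?_
        rw [hkd]
        calc _ ≤ ∫⁻ τ in Set.Icc s (s + 1 / 2), ‖deriv (deriv h) τ‖ₑ :=
              enorm_sub_le_lintegral_deriv_of_contDiffOn_Icc hd.contDiffOn (by linarith)
          _ = ∫⁻ τ in Set.Icc s (s + 1 / 2), Φ s τ := by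
              refine setLIntegral_congr_fun measurableSet_Icc fun τ hτ => ?_
              have : (s, τ) ∈ S := hτ.1
              simp [hΦ, this]
          _ ≤ _ := lintegral_mono_set (Set.Icc_subset_Icc hs.1 (by linarith [hs.2]))
    _ = ∫⁻ τ in Set.Icc (0 : ℝ) 1, ∫⁻ s in Set.Icc (0 : ℝ) (1 / 2), Φ s τ :=
        lintegral_lintegral_swap hΦm.aemeasurable
    _ ≤ ∫⁻ τ in Set.Icc (0 : ℝ) 1, ENNReal.ofReal τ * ‖deriv (deriv h) τ‖ₑ := by
        refine lintegral_mono fun τ => ?_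
        have hm : Measurable fun s => S.indicator (1 : ℝ × ℝ → ℝ≥0∞) (s, τ) :=
          (measurable_one.indicator hSm).comp (by fun_prop)
        rw [hΦ]
        simp only
        rw [lintegral_mul_const _ hm]
        gcongr
        have e2 : ∀ s, S.indicator (1 : ℝ × ℝ → ℝ≥0∞) (s, τ) = (Set.Iic τ).indicator 1 s :=
          fun s => rfl
        simp only [e2]
        rw [lintegral_indicator_one measurableSet_Iic, Measure.restrict_apply measurableSet_Iic]
        calc _ ≤ volume (Set.Icc 0 τ) := measure_mono fun s hs => ⟨hs.2.1, hs.1⟩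
          _ = _ := by simp
    _ = _ := by rw [restrict_Ioc_eq_restrict_Icc]

/-- Solving the second difference for the value at `x` involves values at the midpoint and at `y`,
but no gradient. -/
lemma enorm_le_add_lintegral_fderiv_fderiv {v : E → F} (hv : ContDiff ℝ 2 v) (x y : E) :
    ‖v x‖ₑ ≤ 2 * ‖v (x + (1 / 2 : ℝ) • (y - x))‖ₑ + ‖v y‖ₑ + ∫⁻ t in Set.Ioc (0 : ℝ) 1,
      ENNReal.ofReal t * ‖y - x‖ₑ ^ 2 * ‖fderiv ℝ (fderiv ℝ v) (x + t • (y - x))‖ₑ := by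
  set w := y - x with hw
  set h : ℝ → F := fun t => v (x + t • w) with hh
  have hh2 : ContDiff ℝ 2 h := hv.comp (by fun_prop)
  have hfd : Differentiable ℝ (fderiv ℝ v) :=
    (hv.fderiv_right (m := 1) (by norm_num)).differentiable one_ne_zero
  have e0 : h 0 = v x := by simp [hh]
  have e1 : h 1 = v y := by simp [hh, hw]
  have hd1 : deriv h = fun t => fderiv ℝ v (x + t • w) w := funext fun t =>
    (hasDerivAt_comp_segment (hv.differentiable two_ne_zero _)).deriv
  have hd2 : ∀ t, deriv (deriv h) t = fderiv ℝ (fderiv ℝ v) (x + t • w) w w := by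
    intro t
    rw [hd1]
    have h1 := (hasDerivAt_comp_segment (x := x) (w := w) (t := t) (hfd _)).clm_apply
      (hasDerivAt_const t w)
    simpa using h1.deriv
  calc ‖v x‖ₑ = ‖(h (1 / 2) + h (1 / 2)) - h 1 + (h 1 - h (1 / 2) - (h (1 / 2) - h 0))‖ₑ := by
        rw [← e0]; congr 1; abel
    _ ≤ ‖h (1 / 2)‖ₑ + ‖h (1 / 2)‖ₑ + ‖h 1‖ₑ +
          ‖h 1 - h (1 / 2) - (h (1 / 2) - h 0)‖ₑ := by
        refine (enorm_add_le _ _).trans ?_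
        gcongr
        refine enorm_sub_le.trans ?_
        gcongr
        exact enorm_add_le _ _
    _ ≤ _ := by
        rw [← e1, ← two_mul]
        gcongr
        refine (enorm_second_difference_le hh2).trans (lintegral_mono fun t => ?_)
        simp only
        rw [hd2, mul_assoc]
        gcongr
        calc _ ≤ ‖fderiv ℝ (fderiv ℝ v) (x + t • w) w‖ₑ * ‖w‖ₑ :=
              ContinuousLinearMap.le_opENorm _ _
          _ ≤ ‖fderiv ℝ (fderiv ℝ v) (x + t • w)‖ₑ * ‖w‖ₑ * ‖w‖ₑ := by
              gcongr
              exact ContinuousLinearMap.le_opENorm _ _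
          _ = _ := by ring

end Segments

/-! ### Pointwise bounds by truncated potentials. -/

section Representation

variable {d : ℕ}

lemma setLIntegral_ball_comp_homothety {g : EuclideanSpace ℝ (Fin d) → ℝ≥0∞} (hg : Measurable g)
    (x : EuclideanSpace ℝ (Fin d)) {ρ t : ℝ} (ht : 0 < t) :
    ∫⁻ y in Metric.ball x ρ, g (x + t • (y - x)) =
      (ENNReal.ofReal t ^ d)⁻¹ * ∫⁻ y in Metric.ball x (t * ρ), g y := by
  set φ := (Metric.ball x (t * ρ)).indicator g with hφ
  have hφm : Measurable φ := hg.indicator measurableSet_ball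
  have h1 : ∀ y, (Metric.ball x ρ).indicator (fun y => g (x + t • (y - x))) y =
      φ (x + t • (y - x)) := by
    intro y
    have : y ∈ Metric.ball x ρ ↔ x + t • (y - x) ∈ Metric.ball x (t * ρ) := by
      rw [mem_ball_iff_norm, mem_ball_iff_norm, add_sub_cancel_left, norm_smul,
        Real.norm_of_nonneg ht.le, mul_lt_mul_iff_right₀ ht]
    by_cases hy : y ∈ Metric.ball x ρ
    · rw [hφ, Set.indicator_of_mem hy, Set.indicator_of_mem (this.1 hy)]
    · rw [hφ, Set.indicator_of_notMem hy, Set.indicator_of_notMem (mt this.2 hy)]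
  have hm : Measurable fun y => φ (x + y) := hφm.comp (by fun_prop)
  rw [← lintegral_indicator measurableSet_ball, ← lintegral_indicator measurableSet_ball]
  calc _ = ∫⁻ y, φ (x + t • (y - x)) := lintegral_congr h1
    _ = ∫⁻ y, φ (x + t • y) := lintegral_sub_right_eq_self (fun y => φ (x + t • y)) x
    _ = ∫⁻ y, φ (x + y) ∂(Measure.map (t • ·) volume) :=
        (lintegral_map hm (measurable_const_smul t)).symm
    _ = _ := by
        rw [Measure.map_addHaar_smul volume ht.ne', lintegral_smul_measure,
          lintegral_add_left_eq_self (fun y => φ y) x, finrank_euclideanSpace_fin,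
          abs_of_pos (by positivity), ENNReal.ofReal_inv_of_pos (by positivity),
          ENNReal.ofReal_pow ht.le]
        rfl

/-- Split `t` dyadically. On `(2^{-k-1}, 2^{-k}]` the ball is contained in that of radius `ρ / 2^k`,
replacing `t^{-d}` by its largest value costs `2^d`, and the length of the interval supplies the
last power of `2^{-k}`. -/
lemma lintegral_Ioc_mul_setLIntegral_le (m : ℕ) {g : EuclideanSpace ℝ (Fin d) → ℝ≥0∞}
    {ρ : ℝ} (hρ : 0 < ρ) (x : EuclideanSpace ℝ (Fin d)) :
    ENNReal.ofReal ρ ^ (m + 1) * ∫⁻ t in Set.Ioc (0 : ℝ) 1, ENNReal.ofReal t ^ m *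
      ((ENNReal.ofReal t ^ d)⁻¹ * ∫⁻ y in Metric.ball x (t * ρ), g y) ≤
      2 ^ d * ENNReal.ofReal ρ ^ d * rieszSum (m + 1) ρ g x := by
  set I : ℕ → Set ℝ := fun k => Set.Ioc ((1 / 2) ^ (k + 1)) ((1 / 2) ^ k) with hI
  have hcov : Set.Ioc (0 : ℝ) 1 ⊆ ⋃ k, I k := by
    intro t ht
    obtain ⟨n, hn1, hn2⟩ := exists_nat_pow_near_of_lt_one ht.1 ht.2
      (by norm_num : (0 : ℝ) < 1 / 2) (by norm_num)
    exact Set.mem_iUnion.2 ⟨n, hn1, hn2⟩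
  have hρ0 : ENNReal.ofReal ρ ≠ 0 := by simpa using hρ
  have hterm : ∀ k, ∫⁻ t in I k, ENNReal.ofReal t ^ m *
      ((ENNReal.ofReal t ^ d)⁻¹ * ∫⁻ y in Metric.ball x (t * ρ), g y) ≤
      ENNReal.ofReal ((1 / 2) ^ k) ^ (m + 1) * ((ENNReal.ofReal ((1 / 2) ^ (k + 1)) ^ d)⁻¹ *
        ∫⁻ y in Metric.ball x (ρ / 2 ^ k), g y) := by
    intro k
    calc _ ≤ ∫⁻ _t in I k, ENNReal.ofReal ((1 / 2) ^ k) ^ m *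
          ((ENNReal.ofReal ((1 / 2) ^ (k + 1)) ^ d)⁻¹ *
            ∫⁻ y in Metric.ball x (ρ / 2 ^ k), g y) := by
          refine setLIntegral_mono' measurableSet_Ioc fun t ht => ?_
          gcongr
          · exact ht.2
          · exact ht.1.le
          · calc t * ρ ≤ (1 / 2) ^ k * ρ := by gcongr; exact ht.2
              _ = _ := by rw [div_pow, one_pow]; ring
      _ ≤ _ := by
          rw [setLIntegral_const, pow_succ _ m, mul_right_comm]
          refine mul_le_mul' (mul_le_mul' le_rfl ?_) le_rfl
          rw [hI, Real.volume_Ioc]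
          refine ENNReal.ofReal_le_ofReal ?_
          have : (0 : ℝ) < (1 / 2) ^ (k + 1) := by positivity
          linarith
  calc _ ≤ ENNReal.ofReal ρ ^ (m + 1) * ∑' k, ∫⁻ t in I k, ENNReal.ofReal t ^ m *
      ((ENNReal.ofReal t ^ d)⁻¹ * ∫⁻ y in Metric.ball x (t * ρ), g y) := by
        gcongr
        exact (lintegral_mono_set hcov).trans (lintegral_iUnion_le _ _)
    _ ≤ ∑' k, 2 ^ d * ENNReal.ofReal ρ ^ d * (ENNReal.ofReal (ρ / 2 ^ k) ^ (m + 1) *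
        ((∫⁻ y in Metric.ball x (ρ / 2 ^ k), g y) / ENNReal.ofReal (ρ / 2 ^ k) ^ d)) := by
        rw [← ENNReal.tsum_mul_left]
        refine ENNReal.tsum_le_tsum fun k => ?_
        refine (mul_le_mul_right (hterm k) _).trans_eq ?_
        have e1 : ENNReal.ofReal (ρ / 2 ^ k) = ENNReal.ofReal ρ * ENNReal.ofReal ((1 / 2) ^ k) := by
          rw [← ENNReal.ofReal_mul hρ.le, div_pow, one_pow]; congr 1; ring
        have e2 : (ENNReal.ofReal ((1 / 2) ^ (k + 1)) ^ d)⁻¹ =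
            2 ^ d * ENNReal.ofReal ρ ^ d / ENNReal.ofReal (ρ / 2 ^ k) ^ d := by
          have e3 : ENNReal.ofReal (ρ / 2 ^ k) =
              2 * ENNReal.ofReal ρ * ENNReal.ofReal ((1 / 2) ^ (k + 1)) := by
            rw [← ENNReal.ofReal_ofNat 2, ← ENNReal.ofReal_mul (by norm_num),
              ← ENNReal.ofReal_mul (by positivity)]
            congr 1
            rw [div_pow, one_pow, pow_succ]
            field_simp
          have hne : (2 * ENNReal.ofReal ρ) ^ d ≠ 0 := pow_ne_zero _ (mul_ne_zero two_ne_zero hρ0)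
          have hnt : (2 * ENNReal.ofReal ρ) ^ d ≠ ⊤ :=
            ENNReal.pow_ne_top (ENNReal.mul_ne_top (by simp) ENNReal.ofReal_ne_top)
          rw [e3, mul_pow _ (ENNReal.ofReal _), ← mul_pow]
          have h3 := ENNReal.mul_div_mul_left 1 (ENNReal.ofReal ((1 / 2) ^ (k + 1)) ^ d) hne hnt
          rw [mul_one] at h3
          exact (h3.trans (one_div _)).symm
        have e4 : ENNReal.ofReal (ρ / 2 ^ k) ^ (m + 1) =
            ENNReal.ofReal ρ ^ (m + 1) * ENNReal.ofReal ((1 / 2) ^ k) ^ (m + 1) := by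
          rw [e1, mul_pow]
        rw [e2, e4]
        simp only [div_eq_mul_inv]
        ring
    _ = _ := by rw [ENNReal.tsum_mul_left, rieszSum]

lemma rieszSum_add_const_mul (α : ℕ) (ρ : ℝ) {g h : EuclideanSpace ℝ (Fin d) → ℝ≥0∞}
    (hg : Measurable g) (hh : Measurable h) (a : ℝ≥0∞) (x : EuclideanSpace ℝ (Fin d)) :
    rieszSum α ρ (fun y => g y + a * h y) x = rieszSum α ρ g x + a * rieszSum α ρ h x := by
  simp only [rieszSum]
  rw [← ENNReal.tsum_mul_left, ← ENNReal.tsum_add]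
  refine tsum_congr fun k => ?_
  rw [lintegral_add_left hg, lintegral_const_mul _ hh, ENNReal.add_div, mul_div_assoc]
  ring

lemma setLIntegral_ball_le_rieszSum (α : ℕ) {ρ : ℝ} (hρ : 0 < ρ)
    (g : EuclideanSpace ℝ (Fin d) → ℝ≥0∞) (x : EuclideanSpace ℝ (Fin d)) :
    ∫⁻ y in Metric.ball x ρ, g y ≤
      ENNReal.ofReal ρ ^ d * ((ENNReal.ofReal ρ ^ α)⁻¹ * rieszSum α ρ g x) := by
  have hρ0 : ENNReal.ofReal ρ ≠ 0 := by simpa using hρ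
  have h1 := ENNReal.le_tsum (f := fun k : ℕ => ENNReal.ofReal (ρ / 2 ^ k) ^ α *
    ((∫⁻ y in Metric.ball x (ρ / 2 ^ k), g y) / ENNReal.ofReal (ρ / 2 ^ k) ^ d)) 0
  simp only [pow_zero, div_one] at h1
  calc _ = ENNReal.ofReal ρ ^ d * ((ENNReal.ofReal ρ ^ α)⁻¹ * (ENNReal.ofReal ρ ^ α *
      ((∫⁻ y in Metric.ball x ρ, g y) / ENNReal.ofReal ρ ^ d))) := by
        rw [← mul_assoc (_⁻¹), ENNReal.inv_mul_cancel (pow_ne_zero _ hρ0)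
          (ENNReal.pow_ne_top ENNReal.ofReal_ne_top), one_mul,
          ENNReal.mul_div_cancel (pow_ne_zero _ hρ0) (ENNReal.pow_ne_top ENNReal.ofReal_ne_top)]
    _ ≤ _ := by gcongr; exact h1

/-- Averaging estimates along segments over the endpoints in a ball. -/
theorem le_rieszSum_of_forall_segment (m : ℕ) {ρ : ℝ} (hρ : 0 < ρ)
    {g₀ g₁ : EuclideanSpace ℝ (Fin d) → ℝ≥0∞} (hg₀ : Measurable g₀) (hg₁ : Measurable g₁)
    {x z : EuclideanSpace ℝ (Fin d)} (hz : Metric.ball z (ρ / 2) ⊆ Metric.ball x ρ) {a : ℝ≥0∞}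
    (ha : ∀ y ∈ Metric.ball z (ρ / 2), a ≤ 2 * g₀ (x + (1 / 2 : ℝ) • (y - x)) + g₀ y +
      ∫⁻ t in Set.Ioc (0 : ℝ) 1,
        ENNReal.ofReal t ^ m * ‖y - x‖ₑ ^ (m + 1) * g₁ (x + t • (y - x))) :
    a ≤ (2 ^ (d + 1) + 1) / volume (Metric.ball (0 : EuclideanSpace ℝ (Fin d)) (1 / 2)) *
      rieszSum (m + 1) ρ (fun y => g₁ y + (ENNReal.ofReal ρ ^ (m + 1))⁻¹ * g₀ y) x := by
  set V := volume (Metric.ball (0 : EuclideanSpace ℝ (Fin d)) (1 / 2)) with hV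
  set r := ENNReal.ofReal ρ with hr
  have hV0 : V ≠ 0 := (Metric.measure_ball_pos _ _ (by norm_num)).ne'
  have hVt : V ≠ ⊤ := measure_ball_lt_top.ne
  have hr0 : r ^ d ≠ 0 := pow_ne_zero _ (by simpa [hr] using hρ)
  have hrt : r ^ d ≠ ⊤ := ENNReal.pow_ne_top ENNReal.ofReal_ne_top
  have hvol : volume (Metric.ball z (ρ / 2)) = r ^ d * V := by
    rw [div_eq_mul_one_div, Measure.addHaar_ball_mul_of_pos _ _ hρ, finrank_euclideanSpace_fin,
      ENNReal.ofReal_pow hρ.le]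
  set Φ : EuclideanSpace ℝ (Fin d) → ℝ → ℝ≥0∞ := fun y t =>
    ENNReal.ofReal t ^ m * ‖y - x‖ₑ ^ (m + 1) * g₁ (x + t • (y - x)) with hΦ
  have hΦm : Measurable (Function.uncurry Φ) := by
    have : Measurable fun z : EuclideanSpace ℝ (Fin d) × ℝ => g₁ (x + z.2 • (z.1 - x)) :=
      hg₁.comp (by fun_prop)
    exact (by fun_prop : Measurable fun z : EuclideanSpace ℝ (Fin d) × ℝ =>
      ENNReal.ofReal z.2 ^ m * ‖z.1 - x‖ₑ ^ (m + 1)).mul this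
  have hm1 : Measurable fun y => 2 * g₀ (x + (1 / 2 : ℝ) • (y - x)) :=
    (hg₀.comp (by fun_prop)).const_mul 2
  -- The homothety of ratio `1/2` costs `2^d`; with the factor `2` this is the `2^(d+1)` of the
  -- final constant, the extra `1` coming from the endpoint value.
  have h1 : ∫⁻ y in Metric.ball x ρ, 2 * g₀ (x + (1 / 2 : ℝ) • (y - x)) ≤
      2 ^ (d + 1) * ∫⁻ y in Metric.ball x ρ, g₀ y := by
    have hm : Measurable fun y => g₀ (x + (1 / 2 : ℝ) • (y - x)) := hg₀.comp (by fun_prop)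
    rw [lintegral_const_mul _ hm,
      setLIntegral_ball_comp_homothety hg₀ x (by norm_num), pow_succ, mul_comm _ (2 : ℝ≥0∞),
      mul_assoc]
    have e : (ENNReal.ofReal (1 / 2) ^ d)⁻¹ = 2 ^ d := by
      rw [one_div, ENNReal.ofReal_inv_of_pos (by norm_num), ENNReal.inv_pow, inv_inv]
      simp
    rw [e]
    gcongr
    linarith
  have h3 : ∫⁻ y in Metric.ball x ρ, ∫⁻ t in Set.Ioc (0 : ℝ) 1, Φ y t ≤
      2 ^ d * r ^ d * rieszSum (m + 1) ρ g₁ x := by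
    refine le_trans ?_ (lintegral_Ioc_mul_setLIntegral_le m hρ x)
    rw [lintegral_lintegral_swap hΦm.aemeasurable]
    have hne : r ^ (m + 1) ≠ ⊤ := ENNReal.pow_ne_top ENNReal.ofReal_ne_top
    rw [← lintegral_const_mul' _ _ hne]
    refine setLIntegral_mono' measurableSet_Ioc fun t ht => ?_
    have hm : Measurable fun y => g₁ (x + t • (y - x)) := hg₁.comp (by fun_prop)
    rw [← setLIntegral_ball_comp_homothety hg₁ x ht.1, ← mul_assoc, ← lintegral_const_mul _ hm]
    refine setLIntegral_mono' measurableSet_ball fun y hy => ?_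
    have hyr : ‖y - x‖ₑ ≤ r := by
      rw [← ofReal_norm]
      exact ENNReal.ofReal_le_ofReal (mem_ball_iff_norm.1 hy).le
    calc Φ y t ≤ ENNReal.ofReal t ^ m * r ^ (m + 1) * g₁ (x + t • (y - x)) := by
          simp only [hΦ]
          gcongr
      _ = _ := by ring
  have h2 := setLIntegral_ball_le_rieszSum (m + 1) hρ g₀ x
  have htot : a * (r ^ d * V) ≤ r ^ d * ((2 ^ (d + 1) + 1) *
      rieszSum (m + 1) ρ (fun y => g₁ y + (r ^ (m + 1))⁻¹ * g₀ y) x) := by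
    -- The hypothesis is available only on the small ball; once it has been used, nonnegativity lets
    -- the domain grow to the ball about `x`.
    calc a * (r ^ d * V) = ∫⁻ _y in Metric.ball z (ρ / 2), a := by
          rw [setLIntegral_const, hvol]
      _ ≤ ∫⁻ y in Metric.ball z (ρ / 2), (2 * g₀ (x + (1 / 2 : ℝ) • (y - x)) + g₀ y +
            ∫⁻ t in Set.Ioc (0 : ℝ) 1, Φ y t) := setLIntegral_mono' measurableSet_ball ha
      _ ≤ ∫⁻ y in Metric.ball x ρ, (2 * g₀ (x + (1 / 2 : ℝ) • (y - x)) + g₀ y +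
            ∫⁻ t in Set.Ioc (0 : ℝ) 1, Φ y t) := lintegral_mono_set hz
      _ = (∫⁻ y in Metric.ball x ρ, 2 * g₀ (x + (1 / 2 : ℝ) • (y - x))) +
            (∫⁻ y in Metric.ball x ρ, g₀ y) +
            ∫⁻ y in Metric.ball x ρ, ∫⁻ t in Set.Ioc (0 : ℝ) 1, Φ y t := by
          have hm2 : Measurable fun y => 2 * g₀ (x + (1 / 2 : ℝ) • (y - x)) + g₀ y := hm1.add hg₀
          rw [lintegral_add_left hm2, lintegral_add_left hm1]
      _ ≤ 2 ^ (d + 1) * (r ^ d * ((r ^ (m + 1))⁻¹ * rieszSum (m + 1) ρ g₀ x)) +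
            r ^ d * ((r ^ (m + 1))⁻¹ * rieszSum (m + 1) ρ g₀ x) +
            (2 ^ (d + 1) + 1) * r ^ d * rieszSum (m + 1) ρ g₁ x := by
          refine add_le_add (add_le_add (h1.trans ?_) h2) (h3.trans ?_)
          · gcongr
          · gcongr
            refine le_trans ?_ le_self_add
            exact pow_le_pow_right₀ one_le_two d.le_succ
      _ = _ := by
          rw [rieszSum_add_const_mul _ _ hg₁ hg₀]
          ring
  rw [mul_left_comm] at htot
  have h4 := (ENNReal.mul_le_mul_iff_right hr0 hrt).1 htot
  rw [div_eq_mul_inv, mul_right_comm, ← div_eq_mul_inv]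
  exact (ENNReal.le_div_iff_mul_le (Or.inl hV0) (Or.inl hVt)).2 h4

end Representation

/-! ### Weighted `L_p` bounds for the truncated potential. -/

section PotentialBounds

variable {d : ℕ} {F : Type*} [NormedAddCommGroup F]

lemma conjExponent_lt_of_lt {p r q s : ℝ} (hpr : p.HolderConjugate r) (hqs : q.HolderConjugate s)
    (hpq : p < q) : s < r := by
  have h1 : q⁻¹ < p⁻¹ := inv_strictAnti₀ hpr.pos hpq
  have h2 := hpr.inv_add_inv_eq_one
  have h3 := hqs.inv_add_inv_eq_one
  exact (inv_lt_inv₀ hpr.symm.pos hqs.symm.pos).1 (by linarith)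

lemma volume_ball_natCast_ne_top :
    volume (Metric.ball (0 : EuclideanSpace ℝ (Fin d)) d) ≠ ⊤ := measure_ball_lt_top.ne

/-- A level-`k` cell fits in a ball of radius `6 d ρ / 2^k ≤ R₀`, where the Morrey bound cancels the
power of the scale. -/
lemma MorreyBound.mul_cellAvg_le {q R₀ θ ρ : ℝ} {α : ℕ} (hd : 0 < d) (hq : 0 < q) (hρ : 0 < ρ)
    (hR₀ : 6 * d * ρ ≤ R₀) (hθ : 0 < θ) {f : EuclideanSpace ℝ (Fin d) → F}
    (hf : MorreyBound q α R₀ θ f) (s : Fin d → ℝ) (k : ℕ) (x : EuclideanSpace ℝ (Fin d)) :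
    ENNReal.ofReal (ρ / 2 ^ k) ^ α *
      cellAvg volume (dyadicGrid s ρ k) (fun y => ‖f y‖ₑ ^ q) x ^ (1 / q) ≤
      volume (Metric.ball (0 : EuclideanSpace ℝ (Fin d)) d) ^ (1 / q) * ENNReal.ofReal θ := by
  have hd' : (1 : ℝ) ≤ d := by exact_mod_cast hd
  have hℓ : 0 < 6 * ρ / 2 ^ k := by positivity
  set V := volume (Metric.ball (0 : EuclideanSpace ℝ (Fin d)) d)
  set τ := ρ / 2 ^ k with hτ
  have hτ0 : 0 < τ := by positivity
  have e : d * (6 * ρ / 2 ^ k) = 6 * d * τ := by rw [hτ]; ring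
  have hle : 6 * d * τ ≤ R₀ := by
    refine le_trans ?_ hR₀
    gcongr
    exact div_le_self hρ.le (one_le_pow₀ one_le_two)
  have h1 := cellAvg_gridIndex_le_laverage hd s hℓ (fun y => ‖f y‖ₑ ^ q) x
  rw [e] at h1
  have h2 := hf x (6 * d * τ) (by positivity) hle
  calc _ ≤ ENNReal.ofReal τ ^ α * (V * ⨍⁻ y in Metric.ball x (6 * d * τ), ‖f y‖ₑ ^ q ∂volume) ^ (1 / q) := by
        gcongr
        exact h1
    _ = V ^ (1 / q) * (ENNReal.ofReal τ ^ α *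
          (⨍⁻ y in Metric.ball x (6 * d * τ), ‖f y‖ₑ ^ q ∂volume) ^ (1 / q)) := by
        rw [ENNReal.mul_rpow_of_nonneg _ _ (by positivity)]; ring
    _ ≤ V ^ (1 / q) * (ENNReal.ofReal τ ^ α *
          ENNReal.ofReal (θ * (6 * d * τ) ^ (-(α : ℝ)))) := by gcongr
    _ ≤ _ := by
        gcongr
        rw [← ENNReal.ofReal_pow hτ0.le, ← ENNReal.ofReal_mul (by positivity)]
        refine ENNReal.ofReal_le_ofReal ?_
        rw [Real.rpow_neg (by positivity), Real.rpow_natCast, mul_left_comm]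
        refine mul_le_of_le_one_right hθ.le ?_
        rw [← div_eq_mul_inv]
        refine div_le_one_of_le₀ ?_ (by positivity)
        refine pow_le_pow_left₀ hτ0.le ?_ α
        nlinarith

/-- `L_p` bounds for a truncated potential weighted by a Morrey function. -/
theorem exists_lintegral_enorm_mul_rieszSum_le (hd : 0 < d) {p q : ℝ} (hp : 1 < p) (hpq : p ≤ q)
    {α : ℕ} (hα : α ≠ 0) (K : ℝ≥0) : ∃ C : ℝ≥0, ∀ (ρ R₀ θ : ℝ)
      (f : EuclideanSpace ℝ (Fin d) → F), 0 < ρ → 6 * d * ρ ≤ R₀ → 0 < θ →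
      AEStronglyMeasurable f volume → MorreyBound q α R₀ θ f →
      (p = q → ∀ r : ℝ, 0 < r → ∀ᵐ x,
        ⨍⁻ y in Metric.ball x r, ‖f y‖ₑ ^ p ∂volume ≤ K * ‖f x‖ₑ ^ p) →
      ∀ g : EuclideanSpace ℝ (Fin d) → ℝ≥0∞, Measurable g →
      (∫⁻ x, (‖f x‖ₑ * rieszSum α ρ g x) ^ p) ^ (1 / p) ≤
        C * ENNReal.ofReal θ * (∫⁻ x, g x ^ p) ^ (1 / p) := by
  have hpr := Real.HolderConjugate.conjExponent hp
  have hqs := Real.HolderConjugate.conjExponent (hp.trans_le hpq)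
  set r := p.conjExponent
  set s := q.conjExponent
  have hr := hpr.symm.pos
  have hs := hqs.symm.pos
  set V := volume (Metric.ball (0 : EuclideanSpace ℝ (Fin d)) d) with hV
  have hVt : V ≠ ⊤ := volume_ball_natCast_ne_top
  -- The two branches are the constants of the A₁ and Morrey bilinear estimates; `V` converts
  -- averages over balls to averages over cells.
  set B : ℝ≥0∞ := if p = q then ENNReal.ofReal r * ENNReal.ofReal p * (V * K) ^ (1 / r) else
    ENNReal.ofReal r * ENNReal.ofReal (r / s).conjExponent ^ (1 / s) with hB
  have hBt : B ≠ ⊤ := by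
    rw [hB]
    split_ifs
    · exact ENNReal.mul_ne_top (ENNReal.mul_ne_top ENNReal.ofReal_ne_top ENNReal.ofReal_ne_top)
        (ENNReal.rpow_ne_top_of_nonneg (by positivity)
          (ENNReal.mul_ne_top hVt ENNReal.coe_ne_top))
    · exact ENNReal.mul_ne_top ENNReal.ofReal_ne_top
        (ENNReal.rpow_ne_top_of_nonneg (by positivity) ENNReal.ofReal_ne_top)
  set C : ℝ≥0∞ := 12 ^ d * (2 * B * V ^ (1 / q)) with hC
  have hCt : C ≠ ⊤ := ENNReal.mul_ne_top (ENNReal.pow_ne_top (by simp))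
    (ENNReal.mul_ne_top (ENNReal.mul_ne_top (by simp) hBt)
      (ENNReal.rpow_ne_top_of_nonneg (by have := hqs.pos; positivity) hVt))
  refine ⟨C.toNNReal, fun ρ R₀ θ f hρ hR₀ hθ hfm hM hA g hg => ?_⟩
  rw [ENNReal.coe_toNNReal hCt]
  set f' := hfm.mk f
  have hff' : f =ᵐ[volume] f' := hfm.ae_eq_mk
  set β : EuclideanSpace ℝ (Fin d) → ℝ≥0∞ := fun x => ‖f' x‖ₑ with hβdef
  have hβ : Measurable β := hfm.stronglyMeasurable_mk.enorm
  have havg : ∀ (k : ℕ) (σ : Fin d → ℝ) (a : ℝ) (x : EuclideanSpace ℝ (Fin d)),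
      cellAvg volume (dyadicGrid σ ρ k) (fun y => β y ^ a) x =
        cellAvg volume (dyadicGrid σ ρ k) (fun y => ‖f y‖ₑ ^ a) x := by
    intro k σ a x
    simp only [cellAvg]
    congr 1
    refine lintegral_congr_ae (ae_restrict_of_ae ?_)
    filter_upwards [hff'] with y hy
    rw [hβdef, hy]
  have hmorrey : ∀ (σ : Fin d → ℝ) (k : ℕ) (x : EuclideanSpace ℝ (Fin d)),
      ENNReal.ofReal (ρ / 2 ^ k) ^ α *
        cellAvg volume (dyadicGrid σ ρ k) (fun y => β y ^ q) x ^ (1 / q) ≤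
      V ^ (1 / q) * ENNReal.ofReal θ := by
    intro σ k x
    rw [havg]
    exact hM.mul_cellAvg_le hd hqs.pos hρ hR₀ hθ σ k x
  have key := lintegral_mul_rieszSum_le hpr α hρ hβ (g := g)
    (B := 2 * B * (V ^ (1 / q) * ENNReal.ofReal θ)) (by
      intro σ h n hh
      have hπ : ∀ k, Measurable (dyadicGrid (d := d) σ ρ k) := fun k => measurable_gridIndex _ _
      have href : ∀ k, Function.FactorsThrough (dyadicGrid σ ρ k) (dyadicGrid σ ρ (k + 1)) :=
        gridIndex_factorsThrough σ (6 * ρ)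
      have hfin := volume_dyadicGrid_ne_top σ hρ
      rcases hpq.eq_or_lt with heq | hlt
      · have hB' : B = ENNReal.ofReal r * ENNReal.ofReal p * (V * K) ^ (1 / r) := if_pos heq
        rw [hB']
        refine lintegral_mul_sum_cellAvg_le_of_a1 hpr hπ href hfin
          (sum_ofReal_div_two_pow_le hα hρ) (fun k => pow_ne_zero _ ?_) hβ (fun x => enorm_ne_top)
          (ENNReal.mul_ne_top
            (ENNReal.rpow_ne_top_of_nonneg (by have := hqs.pos; positivity) hVt)
            ENNReal.ofReal_ne_top) ?_ (fun k => ?_) hh hg n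
        · simp only [ne_eq, ENNReal.ofReal_eq_zero, not_le]; positivity
        · rw [heq]; exact hmorrey σ
        · have hℓ : 0 < 6 * ρ / 2 ^ k := by positivity
          filter_upwards [hA heq (d * (6 * ρ / 2 ^ k)) (by positivity), hff'] with x hx hx'
          rw [havg, mul_assoc]
          simp only [hβdef, ← hx']
          exact (cellAvg_gridIndex_le_laverage hd σ hℓ _ x).trans (mul_le_mul_right hx _)
      · have hB' : B = ENNReal.ofReal r * ENNReal.ofReal (r / s).conjExponent ^ (1 / s) :=
          if_neg hlt.ne
        rw [hB']
        have hrs : 1 < r / s := (one_lt_div hs).2 (conjExponent_lt_of_lt hpr hqs hlt)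
        exact lintegral_mul_sum_cellAvg_le_of_morrey hpr hqs
          (Real.HolderConjugate.conjExponent hrs) (div_mul_cancel₀ _ hs.ne') hπ href hfin
          (sum_ofReal_div_two_pow_le hα hρ) hβ (hmorrey σ) hh hg n)
  calc _ = (∫⁻ x, (β x * rieszSum α ρ g x) ^ p) ^ (1 / p) := by
        congr 1
        refine lintegral_congr_ae ?_
        filter_upwards [hff'] with x hx
        rw [hβdef, hx]
    _ ≤ _ := key
    _ = _ := by rw [hC]; ring

/-- The integral over a cell is at most the full integral, leaving the scale to the power `α - d/q`;
for `δ > 0` the resulting factors are summable over levels. -/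
lemma mul_cellAvg_le_of_lintegral_le {q δ : ℝ} {α : ℕ} (hq : 0 < q) (hδ : α - (d : ℝ) / q = δ)
    {ρ : ℝ} (hρ : 0 < ρ) {K : ℝ≥0∞} {w : EuclideanSpace ℝ (Fin d) → ℝ≥0∞}
    (hw : (∫⁻ x, w x ^ q) ^ (1 / q) ≤ K) (s : Fin d → ℝ) (k : ℕ)
    (x : EuclideanSpace ℝ (Fin d)) :
    ENNReal.ofReal (ρ / 2 ^ k) ^ α *
      cellAvg volume (dyadicGrid s ρ k) (fun y => w y ^ q) x ^ (1 / q) ≤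
      K * ENNReal.ofReal (ρ ^ δ) * ENNReal.ofReal (2 ^ (-δ)) ^ k := by
  have hℓ : 0 < 6 * ρ / 2 ^ k := by positivity
  set τ := ρ / 2 ^ k with hτ
  have hτ0 : 0 < τ := by positivity
  have hτl : τ ≤ 6 * ρ / 2 ^ k := by
    rw [hτ]; gcongr; linarith
  have h1 : cellAvg volume (dyadicGrid s ρ k) (fun y => w y ^ q) x ≤
      (∫⁻ x, w x ^ q) / ENNReal.ofReal τ ^ d := by
    rw [cellAvg, dyadicGrid, volume_gridIndex_preimage s hℓ]
    gcongr
    exact Measure.restrict_le_self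
  calc _ ≤ ENNReal.ofReal τ ^ α * ((∫⁻ x, w x ^ q) / ENNReal.ofReal τ ^ d) ^ (1 / q) := by
        gcongr
    _ = (∫⁻ x, w x ^ q) ^ (1 / q) * ENNReal.ofReal (τ ^ δ) := by
        rw [div_eq_mul_inv, ENNReal.mul_rpow_of_nonneg _ _ (by positivity), mul_left_comm]
        congr 1
        have h0 : ENNReal.ofReal τ ≠ 0 := by simpa using hτ0
        rw [← ENNReal.ofReal_rpow_of_pos hτ0, ENNReal.inv_rpow, ← ENNReal.rpow_natCast,
          ← ENNReal.rpow_natCast, ← ENNReal.rpow_mul, ← ENNReal.rpow_neg,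
          ← ENNReal.rpow_add _ _ h0 ENNReal.ofReal_ne_top, ← hδ]
        congr 1
        ring
    _ ≤ K * ENNReal.ofReal (τ ^ δ) := by gcongr
    _ = _ := by
        rw [mul_assoc, ← ENNReal.ofReal_pow (by positivity), ← ENNReal.ofReal_mul (by positivity)]
        congr 2
        rw [hτ, Real.div_rpow hρ.le (by positivity), ← Real.rpow_natCast, ← Real.rpow_natCast,
          ← Real.rpow_mul (by norm_num), ← Real.rpow_mul (by norm_num), div_eq_mul_inv,
          ← Real.rpow_neg (by norm_num)]
        congr 2
        ring

/-- `L_p` bounds for a truncated potential weighted by an `L_q` function, `q > d / α`. -/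
theorem exists_lintegral_mul_rieszSum_le_of_subcritical {p q δ : ℝ} (hp : 1 < p) (hpq : p ≤ q)
    {α : ℕ} (hδ : α - (d : ℝ) / q = δ) (hδ0 : 0 < δ) : ∃ C : ℝ≥0, ∀ (ρ : ℝ) (K : ℝ≥0∞)
      (f : EuclideanSpace ℝ (Fin d) → F), 0 < ρ → AEStronglyMeasurable f volume →
      (∫⁻ x, ‖f x‖ₑ ^ q) ^ (1 / q) ≤ K →
      ∀ g : EuclideanSpace ℝ (Fin d) → ℝ≥0∞, Measurable g →
      (∫⁻ x, (‖f x‖ₑ * rieszSum α ρ g x) ^ p) ^ (1 / p) ≤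
        C * (K * ENNReal.ofReal (ρ ^ δ)) * (∫⁻ x, g x ^ p) ^ (1 / p) := by
  have hpr := Real.HolderConjugate.conjExponent hp
  have hq : 0 < q := hpr.pos.trans_le hpq
  have hε : (∑' k : ℕ, ENNReal.ofReal (2 ^ (-δ)) ^ k) ≠ ⊤ := by
    refine (tsum_geometric_lt_top.2 ?_).ne
    rw [ENNReal.ofReal_lt_one]
    exact Real.rpow_lt_one_of_one_lt_of_neg (by norm_num) (by linarith)
  set S := ∑' k : ℕ, ENNReal.ofReal (2 ^ (-δ)) ^ k
  have hCt : (12 ^ d * S : ℝ≥0∞) ≠ ⊤ := ENNReal.mul_ne_top (ENNReal.pow_ne_top (by simp)) hε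
  refine ⟨(12 ^ d * S).toNNReal, fun ρ K f hρ hfm hK g hg => ?_⟩
  rw [ENNReal.coe_toNNReal hCt]
  set f' := hfm.mk f
  have hff' : f =ᵐ[volume] f' := hfm.ae_eq_mk
  have hβ : Measurable fun x => ‖f' x‖ₑ := hfm.stronglyMeasurable_mk.enorm
  have hK' : (∫⁻ x, ‖f' x‖ₑ ^ q) ^ (1 / q) ≤ K := by
    refine le_of_eq_of_le ?_ hK
    congr 1
    refine lintegral_congr_ae ?_
    filter_upwards [hff'] with x hx
    rw [hx]
  have key := lintegral_mul_rieszSum_le hpr α hρ hβ (g := g)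
    (B := S * (K * ENNReal.ofReal (ρ ^ δ))) (fun σ h n hh =>
      lintegral_mul_sum_cellAvg_le_of_subcritical hpr hpq (fun k => measurable_gridIndex _ _)
        (volume_dyadicGrid_ne_top σ hρ) (fun n => ENNReal.sum_le_tsum _) hβ
        (mul_cellAvg_le_of_lintegral_le hq hδ hρ hK' σ) hh hg n)
  calc _ = (∫⁻ x, (‖f' x‖ₑ * rieszSum α ρ g x) ^ p) ^ (1 / p) := by
        congr 1
        refine lintegral_congr_ae ?_
        filter_upwards [hff'] with x hx
        rw [hx]
    _ ≤ _ := key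
    _ = _ := by ring

end PotentialBounds

/-! ### Transfer to weighted estimates on `B_R`. -/

section LocalEstimates

variable {d : ℕ}

lemma exists_ball_subset_ball_inter_eball {ρ : ℝ} (hρ : 0 < ρ) {R : ℝ≥0∞}
    (hR : ENNReal.ofReal ρ ≤ R) {x : EuclideanSpace ℝ (Fin d)} (hx : x ∈ Metric.eball 0 R) :
    ∃ z, Metric.ball z (ρ / 2) ⊆ Metric.ball x ρ ∧ Metric.ball z (ρ / 2) ⊆ Metric.eball 0 R := by
  rcases eq_or_ne R ⊤ with rfl | hRt
  · exact ⟨x, Metric.ball_subset_ball (by linarith), by simp⟩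
  obtain ⟨R', hR'⟩ : ∃ R' : ℝ, R = ENNReal.ofReal R' := ⟨R.toReal, (ENNReal.ofReal_toReal hRt).symm⟩
  have hρR : ρ ≤ R' := by
    rw [hR'] at hR
    by_contra! h
    exact absurd hR (not_le.2 ((ENNReal.ofReal_lt_ofReal_iff hρ).2 h))
  have hR0 : 0 < R' := hρ.trans_le hρR
  rw [hR', Metric.eball_ofReal] at hx ⊢
  rw [mem_ball_zero_iff] at hx
  -- With `l R' = ρ / 2`, moving `x` to `(1 - l) x` displaces it by less than `ρ / 2` and leaves
  -- distance at least `ρ / 2` to the boundary.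
  set l := ρ / (2 * R') with hl
  have hl0 : 0 < l := by positivity
  have hl1 : l ≤ 1 / 2 := by rw [hl, div_le_iff₀ (by positivity)]; linarith
  have hlR : l * R' = ρ / 2 := by rw [hl]; field_simp
  have hlx : l * ‖x‖ < ρ / 2 := hlR ▸ mul_lt_mul_of_pos_left hx hl0
  refine ⟨(1 - l) • x, fun y hy => ?_, fun y hy => ?_⟩
  · rw [mem_ball_iff_norm] at hy ⊢
    calc ‖y - x‖ = ‖(y - (1 - l) • x) - l • x‖ := by congr 1; module
      _ ≤ ‖y - (1 - l) • x‖ + ‖l • x‖ := norm_sub_le _ _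
      _ < ρ := by rw [norm_smul, Real.norm_of_nonneg hl0.le]; linarith
  · rw [mem_ball_iff_norm] at hy
    rw [mem_ball_zero_iff]
    calc ‖y‖ = ‖(y - (1 - l) • x) + (1 - l) • x‖ := by congr 1; module
      _ ≤ ‖y - (1 - l) • x‖ + ‖(1 - l) • x‖ := norm_add_le _ _
      _ < R' := by
        rw [norm_smul, Real.norm_of_nonneg (by linarith)]
        have : (1 - l) * ‖x‖ ≤ (1 - l) * R' := by gcongr; linarith
        nlinarith

lemma lineMap_mem_eball {R : ℝ≥0∞} {x y : EuclideanSpace ℝ (Fin d)} (hx : x ∈ Metric.eball 0 R)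
    (hy : y ∈ Metric.eball 0 R) {t : ℝ} (ht0 : 0 ≤ t) (ht1 : t ≤ 1) :
    x + t • (y - x) ∈ Metric.eball (0 : EuclideanSpace ℝ (Fin d)) R :=
  (convex_eball _ R).add_smul_sub_mem hx hy ⟨ht0, ht1⟩

/-- The constant in the pointwise bound of a function by a truncated potential. -/
noncomputable def reprConst (d : ℕ) : ℝ≥0∞ :=
  (2 ^ (d + 1) + 1) / volume (Metric.ball (0 : EuclideanSpace ℝ (Fin d)) (1 / 2))

lemma reprConst_ne_top (d : ℕ) : reprConst d ≠ ⊤ :=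
  ENNReal.div_ne_top (ENNReal.add_ne_top.2 ⟨ENNReal.pow_ne_top (by simp), by simp⟩)
    (Metric.measure_ball_pos _ _ (by norm_num)).ne'

variable {F : Type*} [NormedAddCommGroup F] [NormedSpace ℝ F]

/-- The pointwise potential estimate on a ball, of first order. -/
lemma enorm_le_rieszSum_one {v : EuclideanSpace ℝ (Fin d) → F} (hv : ContDiff ℝ 1 v) {ρ : ℝ}
    (hρ : 0 < ρ) {R : ℝ≥0∞} (hR : ENNReal.ofReal ρ ≤ R) {x : EuclideanSpace ℝ (Fin d)}
    (hx : x ∈ Metric.eball 0 R) :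
    ‖v x‖ₑ ≤ reprConst d * rieszSum 1 ρ (fun y =>
      (Metric.eball 0 R).indicator (fun y => ‖fderiv ℝ v y‖ₑ) y +
        (ENNReal.ofReal ρ ^ 1)⁻¹ * (Metric.eball 0 R).indicator (fun y => ‖v y‖ₑ) y) x := by
  obtain ⟨z, hz1, hz2⟩ := exists_ball_subset_ball_inter_eball hρ hR hx
  have hcont := (hv.continuous_fderiv one_ne_zero).enorm
  refine le_rieszSum_of_forall_segment 0 hρ
    (hv.continuous.enorm.measurable.indicator Metric.isOpen_eball.measurableSet)
    (hcont.measurable.indicator Metric.isOpen_eball.measurableSet) hz1 fun y hy => ?_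
  refine (enorm_le_add_lintegral_fderiv hv x y).trans ?_
  rw [Set.indicator_of_mem (hz2 hy)]
  gcongr ?_ + ?_
  · exact le_add_self
  · refine setLIntegral_mono' measurableSet_Ioc fun t ht => ?_
    rw [Set.indicator_of_mem (lineMap_mem_eball hx (hz2 hy) ht.1.le ht.2)]
    simp

/-- The pointwise potential estimate on a ball, of second order. -/
lemma enorm_le_rieszSum_two {v : EuclideanSpace ℝ (Fin d) → F} (hv : ContDiff ℝ 2 v) {ρ : ℝ}
    (hρ : 0 < ρ) {R : ℝ≥0∞} (hR : ENNReal.ofReal ρ ≤ R) {x : EuclideanSpace ℝ (Fin d)}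
    (hx : x ∈ Metric.eball 0 R) :
    ‖v x‖ₑ ≤ reprConst d * rieszSum 2 ρ (fun y =>
      (Metric.eball 0 R).indicator (fun y => ‖fderiv ℝ (fderiv ℝ v) y‖ₑ) y +
        (ENNReal.ofReal ρ ^ 2)⁻¹ * (Metric.eball 0 R).indicator (fun y => ‖v y‖ₑ) y) x := by
  obtain ⟨z, hz1, hz2⟩ := exists_ball_subset_ball_inter_eball hρ hR hx
  have hcont := ((hv.fderiv_right (m := 1) (by norm_num)).continuous_fderiv one_ne_zero).enorm
  refine le_rieszSum_of_forall_segment 1 hρ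
    (hv.continuous.enorm.measurable.indicator Metric.isOpen_eball.measurableSet)
    (hcont.measurable.indicator Metric.isOpen_eball.measurableSet) hz1 fun y hy => ?_
  refine (enorm_le_add_lintegral_fderiv_fderiv hv x y).trans ?_
  rw [Set.indicator_of_mem (hz2 hy),
    Set.indicator_of_mem (lineMap_mem_eball hx (hz2 hy) (by norm_num) (by norm_num))]
  refine add_le_add le_rfl ?_
  refine setLIntegral_mono' measurableSet_Ioc fun t ht => ?_
  rw [Set.indicator_of_mem (lineMap_mem_eball hx (hz2 hy) ht.1.le ht.2)]
  simp

lemma lpBall_eq_lintegral {p : ℝ} (hp : 0 < p) (R : ℝ≥0∞) {G : Type*} [NormedAddCommGroup G]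
    (f : EuclideanSpace ℝ (Fin d) → G) :
    lpBall p R f = (∫⁻ x in Metric.eball 0 R, ‖f x‖ₑ ^ p) ^ (1 / p) := by
  rw [lpBall, eLpNorm_eq_lintegral_rpow_enorm_toReal (by simpa using hp) ENNReal.ofReal_ne_top,
    ENNReal.toReal_ofReal hp.le]

lemma lintegral_indicator_rpow {p : ℝ} (hp : 0 < p) (R : ℝ≥0∞)
    (g : EuclideanSpace ℝ (Fin d) → ℝ≥0∞) :
    ∫⁻ x, (Metric.eball 0 R).indicator g x ^ p = ∫⁻ x in Metric.eball 0 R, g x ^ p := by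
  rw [← lintegral_indicator Metric.isOpen_eball.measurableSet]
  refine lintegral_congr fun x => ?_
  by_cases hx : x ∈ Metric.eball (0 : EuclideanSpace ℝ (Fin d)) R
  · simp only [Set.indicator_of_mem hx]
  · simp only [Set.indicator_of_notMem hx, ENNReal.zero_rpow_of_pos hp]

/-- A weighted potential estimate together with a pointwise bound gives a weighted estimate
on a ball. -/
lemma lpBall_le_of_rieszSum {G H I W : Type*} [NormedAddCommGroup G] [NormedAddCommGroup H]
    [NormedAddCommGroup I] [NormedAddCommGroup W] {p : ℝ} (hp : 1 ≤ p) {α : ℕ} {ρ : ℝ}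
    {R C A : ℝ≥0∞}
    {f : EuclideanSpace ℝ (Fin d) → G} {v : EuclideanSpace ℝ (Fin d) → H}
    {w : EuclideanSpace ℝ (Fin d) → I} {fv : EuclideanSpace ℝ (Fin d) → W}
    (hfv : ∀ x, ‖fv x‖ₑ = ‖f x‖ₑ * ‖v x‖ₑ)
    (hv : Continuous v) (hw : Continuous w)
    (hA : ∀ g : EuclideanSpace ℝ (Fin d) → ℝ≥0∞, Measurable g →
      (∫⁻ x, (‖f x‖ₑ * rieszSum α ρ g x) ^ p) ^ (1 / p) ≤ A * (∫⁻ x, g x ^ p) ^ (1 / p))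
    (hpt : ∀ x ∈ Metric.eball (0 : EuclideanSpace ℝ (Fin d)) R,
      ‖v x‖ₑ ≤ C * rieszSum α ρ (fun y => (Metric.eball 0 R).indicator (fun y => ‖w y‖ₑ) y +
        (ENNReal.ofReal ρ ^ α)⁻¹ * (Metric.eball 0 R).indicator (fun y => ‖v y‖ₑ) y) x)
    (hC : C ≠ ⊤) :
    lpBall p R fv ≤
      C * A * (lpBall p R w + (ENNReal.ofReal ρ ^ α)⁻¹ * lpBall p R v) := by
  have hp0 : 0 < p := by linarith
  set S := Metric.eball (0 : EuclideanSpace ℝ (Fin d)) R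
  set a := (ENNReal.ofReal ρ ^ α)⁻¹
  have hS : MeasurableSet S := Metric.isOpen_eball.measurableSet
  have hm1 : Measurable (S.indicator fun y => ‖w y‖ₑ) := hw.enorm.measurable.indicator hS
  have hm2 : Measurable (S.indicator fun y => ‖v y‖ₑ) := hv.enorm.measurable.indicator hS
  set g : EuclideanSpace ℝ (Fin d) → ℝ≥0∞ := fun y =>
    S.indicator (fun y => ‖w y‖ₑ) y + a * S.indicator (fun y => ‖v y‖ₑ) y with hg
  have hmul : ∀ (b : ℝ≥0∞), b ≠ ⊤ → ∀ h : EuclideanSpace ℝ (Fin d) → ℝ≥0∞,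
      (∫⁻ x, (b * h x) ^ p) ^ (1 / p) = b * (∫⁻ x, h x ^ p) ^ (1 / p) := by
    intro b hb h
    simp only [ENNReal.mul_rpow_of_nonneg _ _ hp0.le]
    rw [lintegral_const_mul' _ _ (ENNReal.rpow_ne_top_of_nonneg hp0.le hb),
      ENNReal.mul_rpow_of_nonneg _ _ (by positivity), ← ENNReal.rpow_mul,
      mul_one_div_cancel hp0.ne', ENNReal.rpow_one]
  -- Here `a` may be infinite, as `ρ` is not assumed positive; measurability of `h` replaces
  -- finiteness.
  have hmul' : ∀ h : EuclideanSpace ℝ (Fin d) → ℝ≥0∞, Measurable h →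
      (∫⁻ x, (a * h x) ^ p) ^ (1 / p) = a * (∫⁻ x, h x ^ p) ^ (1 / p) := by
    intro h hh
    simp only [ENNReal.mul_rpow_of_nonneg _ _ hp0.le]
    rw [lintegral_const_mul _ (hh.pow_const p),
      ENNReal.mul_rpow_of_nonneg _ _ (by positivity), ← ENNReal.rpow_mul,
      mul_one_div_cancel hp0.ne', ENNReal.rpow_one]
  calc lpBall p R fv = (∫⁻ x in S, (‖f x‖ₑ * ‖v x‖ₑ) ^ p) ^ (1 / p) := by
        rw [lpBall_eq_lintegral hp0]; simp only [hfv]; rfl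
    _ ≤ (∫⁻ x in S, (C * (‖f x‖ₑ * rieszSum α ρ g x)) ^ p) ^ (1 / p) := by
        refine ENNReal.rpow_le_rpow (setLIntegral_mono' hS fun x hx => ?_) (by positivity)
        refine ENNReal.rpow_le_rpow ?_ hp0.le
        rw [mul_left_comm]
        gcongr
        exact hpt x hx
    _ ≤ (∫⁻ x, (C * (‖f x‖ₑ * rieszSum α ρ g x)) ^ p) ^ (1 / p) := by
        gcongr
        exact Measure.restrict_le_self
    _ ≤ C * (A * (∫⁻ x, g x ^ p) ^ (1 / p)) := by
        rw [hmul C hC]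
        gcongr
        exact hA g (hm1.add (hm2.const_mul a))
    _ ≤ C * (A * ((∫⁻ x, S.indicator (fun y => ‖w y‖ₑ) x ^ p) ^ (1 / p) +
          (∫⁻ x, (a * S.indicator (fun y => ‖v y‖ₑ) x) ^ p) ^ (1 / p))) := by
        gcongr
        exact ENNReal.lintegral_Lp_add_le hm1.aemeasurable (hm2.const_mul a).aemeasurable hp
    _ = _ := by
        rw [hmul' _ hm2, lintegral_indicator_rpow hp0, lintegral_indicator_rpow hp0,
          lpBall_eq_lintegral hp0, lpBall_eq_lintegral hp0, mul_assoc]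

lemma lpBall_iteratedFDeriv_two (p : ℝ) (R : ℝ≥0∞) (u : EuclideanSpace ℝ (Fin d) → ℝ) :
    lpBall p R (iteratedFDeriv ℝ 2 u) = lpBall p R (fderiv ℝ (fderiv ℝ u)) := by
  refine eLpNorm_congr_norm_ae (Filter.Eventually.of_forall fun x => ?_)
  have h1 := norm_iteratedFDeriv_fderiv (𝕜 := ℝ) (f := u) (x := x) (n := 1)
  rw [norm_iteratedFDeriv_one] at h1
  exact h1.symm

/-- Doubling `K` makes the inequality for the infimum strict, so an admissible constant below `2 K`
exists and attainment need not be discussed. -/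
lemma laverage_le_of_a1Const_le {K : ℝ} (hK : 0 < K) {f : EuclideanSpace ℝ (Fin d) → ℝ}
    (hf : a1Const f ≤ ENNReal.ofReal K) {r : ℝ} (hr : 0 < r) :
    ∀ᵐ x, ⨍⁻ y in Metric.ball x r, ‖f y‖ₑ ∂volume ≤ ENNReal.ofReal (2 * K) * ‖f x‖ₑ := by
  have hlt : a1Const f < ENNReal.ofReal (2 * K) :=
    hf.trans_lt ((ENNReal.ofReal_lt_ofReal_iff (by linarith)).2 (by linarith))
  obtain ⟨N, hN, hNlt⟩ := sInf_lt_iff.1 hlt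
  filter_upwards [hN] with x hx
  calc _ ≤ hlMaximal f x :=
        le_iSup₂ (f := fun (r : ℝ) (_ : 0 < r) => ⨍⁻ y in Metric.ball x r, ‖f y‖ₑ ∂volume) r hr
    _ ≤ _ := hx.trans (mul_le_mul_left hNlt.le _)

lemma laverage_rpow_le_of_a1Const_le {G : Type*} [NormedAddCommGroup G] {K p : ℝ} (hp : 0 < p)
    (hK : 0 < K) {f : EuclideanSpace ℝ (Fin d) → G}
    (hf : a1Const (fun x => ‖f x‖ ^ p) ≤ ENNReal.ofReal K) {r : ℝ} (hr : 0 < r) :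
    ∀ᵐ x, ⨍⁻ y in Metric.ball x r, ‖f y‖ₑ ^ p ∂volume ≤ (2 * K).toNNReal * ‖f x‖ₑ ^ p := by
  have h := laverage_le_of_a1Const_le hK hf hr
  simp only [Real.enorm_rpow_of_nonneg (norm_nonneg _) hp.le, enorm_norm] at h
  exact h

/-- The scale at which the Morrey condition is used on a ball of radius `R`. -/
lemma exists_scale (hd : 0 < d) {R₀ : ℝ} (hR₀ : 0 < R₀) {R : ℝ≥0∞} (hR : 0 < R) :
    ∃ ρ : ℝ, 0 < ρ ∧ 6 * d * ρ ≤ R₀ ∧ ENNReal.ofReal ρ ≤ R ∧ ∀ α : ℕ,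
      (ENNReal.ofReal ρ ^ α)⁻¹ ≤
        (6 * d) ^ α * ((R ^ α)⁻¹ + (ENNReal.ofReal R₀ ^ α)⁻¹) := by
  -- The scale is `min(R, R₀) / (6 d)`, finite even for `R = ∞`; the divisor makes the balls
  -- containing the coarsest cells admissible in the Morrey condition.
  set M := min R (ENNReal.ofReal R₀) with hM
  have hMt : M ≠ ⊤ := ne_top_of_le_ne_top ENNReal.ofReal_ne_top (min_le_right _ _)
  have hM0 : 0 < M := lt_min hR (by simpa using hR₀)
  have hd' : (1 : ℝ) ≤ d := by exact_mod_cast hd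
  have hm : 0 < M.toReal := ENNReal.toReal_pos hM0.ne' hMt
  have hdp : (0 : ℝ) < 6 * d := by positivity
  have e : ENNReal.ofReal (M.toReal / (6 * d)) = M / (6 * d) := by
    rw [ENNReal.ofReal_div_of_pos hdp, ENNReal.ofReal_toReal hMt, ENNReal.ofReal_mul (by norm_num)]
    simp
  refine ⟨M.toReal / (6 * d), by positivity, ?_, ?_, fun α => ?_⟩
  · rw [mul_div_cancel₀ _ hdp.ne']
    exact ENNReal.toReal_le_of_le_ofReal hR₀.le (min_le_right _ _)
  · refine le_trans ?_ (min_le_left R (ENNReal.ofReal R₀))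
    rw [← hM]
    conv_rhs => rw [← ENNReal.ofReal_toReal hMt]
    exact ENNReal.ofReal_le_ofReal (div_le_self hm.le (by linarith))
  · have h6 : (6 * d : ℝ≥0∞) ≠ 0 := by simp; omega
    have h6t : (6 * d : ℝ≥0∞) ≠ ⊤ := ENNReal.mul_ne_top (by simp) (by simp)
    rw [e, ENNReal.div_eq_inv_mul, mul_pow, ENNReal.mul_inv (Or.inl (by simp [h6t]))
      (Or.inr (pow_ne_zero _ hM0.ne')), ENNReal.inv_pow, inv_inv]
    gcongr
    rcases min_choice R (ENNReal.ofReal R₀) with h | h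
    · rw [hM, h]; exact le_self_add
    · rw [hM, h]; exact le_add_self

/-- The second-order weighted estimate on a ball, at a fixed scale `ρ`. -/
lemma lpBall_le_of_rieszSum_two {G W H : Type*} [NormedAddCommGroup G] [NormedAddCommGroup W]
    [NormedAddCommGroup H] [NormedSpace ℝ H] {p : ℝ} (hp : 1 ≤ p) {ρ : ℝ} (hρ : 0 < ρ)
    {R A : ℝ≥0∞} (hR : ENNReal.ofReal ρ ≤ R)
    {f : EuclideanSpace ℝ (Fin d) → G} {v : EuclideanSpace ℝ (Fin d) → H}
    {fv : EuclideanSpace ℝ (Fin d) → W} (hfv : ∀ x, ‖fv x‖ₑ = ‖f x‖ₑ * ‖v x‖ₑ)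
    (hv : ContDiff ℝ 2 v)
    (hA : ∀ g : EuclideanSpace ℝ (Fin d) → ℝ≥0∞, Measurable g →
      (∫⁻ x, (‖f x‖ₑ * rieszSum 2 ρ g x) ^ p) ^ (1 / p) ≤ A * (∫⁻ x, g x ^ p) ^ (1 / p)) :
    lpBall p R fv ≤ reprConst d * A *
      (lpBall p R (fderiv ℝ (fderiv ℝ v)) + (ENNReal.ofReal ρ ^ 2)⁻¹ * lpBall p R v) :=
  lpBall_le_of_rieszSum hp hfv hv.continuous
    ((hv.fderiv_right (m := 1) (by norm_num)).continuous_fderiv one_ne_zero) hA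
    (fun _ hx => enorm_le_rieszSum_two hv hρ hR hx) (reprConst_ne_top d)

end LocalEstimates

/-! ### Optimization over the scale. -/

section Interpolation

/-- The two terms balance at `ρ = (B/A)^{1/2}`. If this is allowed, it yields the product of powers;
otherwise `ρ = R`, and `R² A < B` makes the lower-order term dominate. -/
lemma le_interpolation_of_pos {δ : ℝ} {R L N : ℝ≥0∞} (hR : R ≠ 0)
    {A B : ℝ≥0∞} (hA : A ≠ ⊤) (hB : B ≠ ⊤) (hA0 : A ≠ 0) (hB0 : B ≠ 0)
    (h : ∀ ρ : ℝ, 0 < ρ → ENNReal.ofReal ρ ≤ R →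
      L ≤ N * (ENNReal.ofReal (ρ ^ (2 - δ)) * (A + (ENNReal.ofReal ρ ^ 2)⁻¹ * B))) :
    L ≤ N * 2 * (A ^ (δ / 2) * B ^ (1 - δ / 2) + R ^ (-δ) * B) := by
  obtain ⟨a, ha, rfl⟩ : ∃ a : ℝ, 0 < a ∧ A = ENNReal.ofReal a :=
    ⟨A.toReal, ENNReal.toReal_pos hA0 hA, (ENNReal.ofReal_toReal hA).symm⟩
  obtain ⟨b, hb, rfl⟩ : ∃ b : ℝ, 0 < b ∧ B = ENNReal.ofReal b :=
    ⟨B.toReal, ENNReal.toReal_pos hB0 hB, (ENNReal.ofReal_toReal hB).symm⟩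
  have hval : ∀ ρ : ℝ, 0 < ρ → ENNReal.ofReal (ρ ^ (2 - δ)) *
      (ENNReal.ofReal a + (ENNReal.ofReal ρ ^ 2)⁻¹ * ENNReal.ofReal b) =
      ENNReal.ofReal (ρ ^ (2 - δ) * (a + (ρ ^ 2)⁻¹ * b)) := by
    intro ρ hρ
    rw [← ENNReal.ofReal_pow hρ.le, ← ENNReal.ofReal_inv_of_pos (by positivity),
      ← ENNReal.ofReal_mul (by positivity), ← ENNReal.ofReal_add ha.le (by positivity),
      ← ENNReal.ofReal_mul (by positivity)]
  by_cases hcase : ENNReal.ofReal ((b / a) ^ (1 / 2 : ℝ)) ≤ R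
  · refine (h _ (by positivity) hcase).trans ?_
    rw [hval _ (by positivity), mul_assoc]
    gcongr N * ?_
    refine le_trans ?_ (mul_le_mul_right le_self_add 2)
    rw [ENNReal.ofReal_rpow_of_pos ha, ENNReal.ofReal_rpow_of_pos hb,
      ← ENNReal.ofReal_ofNat 2, ← ENNReal.ofReal_mul (by positivity),
      ← ENNReal.ofReal_mul (by norm_num)]
    refine ENNReal.ofReal_le_ofReal (le_of_eq ?_)
    have e1 : ((b / a) ^ (1 / 2 : ℝ)) ^ 2 = b / a := by
      rw [← Real.rpow_natCast, ← Real.rpow_mul (by positivity)]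
      norm_num
    have e2 : (b / a)⁻¹ * b = a := by field_simp
    rw [e1, e2, ← Real.rpow_mul (by positivity), Real.div_rpow hb.le ha.le]
    have e3 : (1 / 2 : ℝ) * (2 - δ) = 1 - δ / 2 := by ring
    have e4 : a ^ (δ / 2) = a / a ^ (1 - δ / 2) := by
      rw [eq_div_iff (by positivity), ← Real.rpow_add ha]
      simp
    rw [e3, e4]
    ring
  · have hlt := not_le.1 hcase
    have hRt : R ≠ ⊤ := (hlt.trans_le le_top).ne
    obtain ⟨r, hr, rfl⟩ : ∃ r : ℝ, 0 < r ∧ R = ENNReal.ofReal r :=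
      ⟨R.toReal, ENNReal.toReal_pos hR hRt, (ENNReal.ofReal_toReal hRt).symm⟩
    refine (h r hr le_rfl).trans ?_
    rw [hval _ hr, mul_assoc]
    gcongr N * ?_
    refine le_trans ?_ (mul_le_mul_right le_add_self 2)
    rw [ENNReal.ofReal_rpow_of_pos hr, ← ENNReal.ofReal_ofNat 2,
      ← ENNReal.ofReal_mul (by positivity), ← ENNReal.ofReal_mul (by norm_num)]
    refine ENNReal.ofReal_le_ofReal ?_
    have hr2 : r < (b / a) ^ (1 / 2 : ℝ) := (ENNReal.ofReal_lt_ofReal_iff (by positivity)).1 hlt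
    have hr3 : r ^ 2 < b / a := by
      calc r ^ 2 < ((b / a) ^ (1 / 2 : ℝ)) ^ 2 := by gcongr
        _ = b / a := by
          rw [← Real.rpow_natCast, ← Real.rpow_mul (by positivity)]
          norm_num
    rw [lt_div_iff₀ ha] at hr3
    have e : r ^ (2 - δ) = r ^ 2 * r ^ (-δ) := by
      rw [sub_eq_add_neg, Real.rpow_add hr]; norm_num
    have e5 : r ^ 2 * (r ^ 2)⁻¹ = 1 := mul_inv_cancel₀ (by positivity)
    calc r ^ (2 - δ) * (a + (r ^ 2)⁻¹ * b)
        = r ^ (-δ) * (r ^ 2 * a + r ^ 2 * (r ^ 2)⁻¹ * b) := by rw [e]; ring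
      _ ≤ r ^ (-δ) * (b + b) := by rw [e5, one_mul]; gcongr
      _ = _ := by ring

/-- Optimizing a family of estimates over the scale `ρ ≤ R`. -/
theorem le_interpolation {δ : ℝ} (hδ0 : 0 < δ) (hδ2 : δ < 2) {R L N : ℝ≥0∞} (hR : R ≠ 0)
    (hN : N ≠ ⊤) {A B : ℝ≥0∞} (hA : A ≠ ⊤) (hB : B ≠ ⊤)
    (h : ∀ ρ : ℝ, 0 < ρ → ENNReal.ofReal ρ ≤ R →
      L ≤ N * (ENNReal.ofReal (ρ ^ (2 - δ)) * (A + (ENNReal.ofReal ρ ^ 2)⁻¹ * B))) :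
    L ≤ N * 2 * (A ^ (δ / 2) * B ^ (1 - δ / 2) + R ^ (-δ) * B) := by
  have hRδ : R ^ (-δ) ≠ ⊤ := by
    rw [ENNReal.rpow_neg]
    exact ENNReal.inv_ne_top.2 (by simp [ENNReal.rpow_eq_zero_iff, hR, hδ0.not_gt])
  -- `A` and `B` may vanish, so both are increased by a finite `ε > 0`, which preserves the
  -- hypothesis, and then `ε → 0`.
  have hlim : ∀ D : ℝ≥0∞, Filter.Tendsto (fun ε : ℝ≥0∞ => D + ε) (nhdsWithin 0 (Set.Ioo 0 ⊤))
      (nhds D) := fun D => by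
    have h1 : Filter.Tendsto (fun ε : ℝ≥0∞ => D + ε) (nhds 0) (nhds (D + 0)) :=
      tendsto_const_nhds.add Filter.tendsto_id
    rw [add_zero] at h1
    exact h1.mono_left nhdsWithin_le_nhds
  have hne : (nhdsWithin (0 : ℝ≥0∞) (Set.Ioo 0 ⊤)).NeBot := by
    rw [← mem_closure_iff_nhdsWithin_neBot, closure_Ioo ENNReal.zero_ne_top]
    exact ⟨le_rfl, le_top⟩
  have hA' : A ^ (δ / 2) ≠ ⊤ := ENNReal.rpow_ne_top_of_nonneg (by linarith) hA
  have hB' : B ^ (1 - δ / 2) ≠ ⊤ := ENNReal.rpow_ne_top_of_nonneg (by linarith) hB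
  have ht : Filter.Tendsto (fun ε : ℝ≥0∞ => N * 2 * ((A + ε) ^ (δ / 2) * (B + ε) ^ (1 - δ / 2) +
      R ^ (-δ) * (B + ε))) (nhdsWithin 0 (Set.Ioo 0 ⊤))
      (nhds (N * 2 * (A ^ (δ / 2) * B ^ (1 - δ / 2) + R ^ (-δ) * B))) := by
    refine ENNReal.Tendsto.const_mul (Filter.Tendsto.add ?_ ?_)
      (Or.inr (ENNReal.mul_ne_top hN (by simp)))
    · exact ENNReal.Tendsto.mul ((ENNReal.continuous_rpow_const.tendsto A).comp (hlim A))
        (Or.inr hB') ((ENNReal.continuous_rpow_const.tendsto B).comp (hlim B)) (Or.inr hA')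
    · exact ENNReal.Tendsto.const_mul (hlim B) (Or.inr hRδ)
  refine ge_of_tendsto ht ?_
  filter_upwards [self_mem_nhdsWithin] with ε hε
  refine le_interpolation_of_pos hR (ENNReal.add_ne_top.2 ⟨hA, hε.2.ne⟩)
    (ENNReal.add_ne_top.2 ⟨hB, hε.2.ne⟩) (by simp [hε.1.ne']) (by simp [hε.1.ne'])
    fun ρ hρ hρR => (h ρ hρ hρR).trans ?_
  gcongr <;> exact le_self_add

end Interpolation

/-! ### Assembly of the three parts. -/

section Assembly

variable {d : ℕ}

/-- The constant obtained from a potential bound with constant `C` at the scale of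
`exists_scale`. -/
noncomputable def assembledConst (d α : ℕ) (C : ℝ≥0) : ℝ≥0 :=
  (reprConst d * C * (6 * d) ^ α).toNNReal

lemma le_assembledConst_mul (hd : 0 < d) (α : ℕ) (C : ℝ≥0) {L θ A B a s : ℝ≥0∞}
    (hL : L ≤ reprConst d * (C * θ) * (A + a * B)) (ha : a ≤ (6 * d) ^ α * s) :
    L ≤ assembledConst d α C * θ * (A + s * B) := by
  have h6t : (6 * d : ℝ≥0∞) ≠ ⊤ := ENNReal.mul_ne_top (by simp) (by simp)
  have h61 : (1 : ℝ≥0∞) ≤ (6 * d) ^ α := by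
    refine one_le_pow₀ ?_
    have : (1 : ℝ≥0∞) ≤ ((6 * d : ℕ) : ℝ≥0∞) := by exact_mod_cast (by omega : 1 ≤ 6 * d)
    simpa using this
  rw [assembledConst, ENNReal.coe_toNNReal (ENNReal.mul_ne_top
    (ENNReal.mul_ne_top (reprConst_ne_top d) ENNReal.coe_ne_top) (ENNReal.pow_ne_top h6t))]
  calc L ≤ reprConst d * (C * θ) * (A + a * B) := hL
    _ ≤ reprConst d * (C * θ) * ((6 * d) ^ α * A + (6 * d) ^ α * s * B) := by
        gcongr
        exact le_mul_of_one_le_left' h61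
    _ = _ := by ring

lemma lpBall_ne_top {F : Type*} [NormedAddCommGroup F] (p : ℝ) (R : ℝ≥0∞)
    {f : EuclideanSpace ℝ (Fin d) → F} (hf : Continuous f) (hfs : HasCompactSupport f) :
    lpBall p R f ≠ ⊤ :=
  ((eLpNorm_mono_measure f Measure.restrict_le_self).trans_lt
    (hf.memLp_of_hasCompactSupport hfs).2).ne

variable {p : ℝ}

/-- The drift term estimates. -/
theorem exists_drift_bound (hd0 : 0 < d) (hp : 1 < p) {q_b K : ℝ} (hpq : p ≤ q_b) (hK : 0 < K) :
    ∃ N₀ : ℝ≥0,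
      ∀ (R₀ θ_b : ℝ) (b : EuclideanSpace ℝ (Fin d) → EuclideanSpace ℝ (Fin d)),
        0 < R₀ → 0 < θ_b → DriftAssumption p q_b K R₀ θ_b b →
      ∀ (u : EuclideanSpace ℝ (Fin d) → ℝ) (R : ℝ≥0∞),
        ContDiff ℝ ∞ u → HasCompactSupport u → 0 < R →
        lpBall p R (fun x => u x • b x) ≤
            N₀ * ENNReal.ofReal θ_b * lpBall p R (fderiv ℝ u) +
            N₀ * ENNReal.ofReal θ_b * (R⁻¹ + (ENNReal.ofReal R₀)⁻¹) * lpBall p R u ∧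
        lpBall p R (fun x => ‖b x‖ * ‖fderiv ℝ u x‖) ≤
            N₀ * ENNReal.ofReal θ_b * lpBall p R (iteratedFDeriv ℝ 2 u) +
            N₀ * ENNReal.ofReal θ_b * (R⁻¹ + (ENNReal.ofReal R₀)⁻¹) *
              lpBall p R (fderiv ℝ u) := by
  have hp0 : 0 < p := by linarith
  obtain ⟨C, hC⟩ := exists_lintegral_enorm_mul_rieszSum_le (F := EuclideanSpace ℝ (Fin d)) hd0 hp
    hpq one_ne_zero (2 * K).toNNReal
  refine ⟨assembledConst d 1 C, fun R₀ θ b hR₀ hθ hb u R hu _ hR => ?_⟩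
  obtain ⟨ρ, hρ, hρR₀, hρR, hscale⟩ := exists_scale hd0 hR₀ hR
  have hpot := hC ρ R₀ θ b hρ hρR₀ hθ hb.measurable (by simpa using hb.morrey)
    fun h r hr => laverage_rpow_le_of_a1Const_le hp0 hK (hb.a1 h) hr
  have hsc := hscale 1
  simp only [pow_one R, pow_one (ENNReal.ofReal R₀)] at hsc
  have hu2 : ContDiff ℝ 2 u := by exact_mod_cast contDiff_infty.1 hu 2
  have hu1 : ContDiff ℝ 1 u := hu2.of_le one_le_two
  have hdu : ContDiff ℝ 1 (fderiv ℝ u) := hu2.fderiv_right (by norm_num)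
  constructor
  · have h := le_assembledConst_mul hd0 1 C (lpBall_le_of_rieszSum hp.le
      (fv := fun x => u x • b x) (fun x => by rw [enorm_smul, mul_comm])
      hu.continuous hdu.continuous hpot
      (fun x hx => enorm_le_rieszSum_one hu1 hρ hρR hx) (reprConst_ne_top d)) hsc
    rwa [mul_add, ← mul_assoc] at h
  -- The same argument for the vector-valued function `Du` in place of `u`.
  · have h := le_assembledConst_mul hd0 1 C (lpBall_le_of_rieszSum hp.le
      (fv := fun x => ‖b x‖ * ‖fderiv ℝ u x‖) (fun x => by simp [enorm_mul])
      hdu.continuous (hdu.continuous_fderiv one_ne_zero) hpot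
      (fun x hx => enorm_le_rieszSum_one hdu hρ hρR hx) (reprConst_ne_top d)) hsc
    rwa [mul_add, ← mul_assoc, ← lpBall_iteratedFDeriv_two] at h

/-- The zeroth-order term estimate for `c ∈ L_q` with `q > d / 2`. -/
theorem exists_subcritical_potential_bound (hd0 : 0 < d) (hp : 1 < p) {q_c : ℝ} (hpq : p ≤ q_c)
    (hq : (d : ℝ) / 2 < q_c) :
    ∃ N : ℝ≥0,
      ∀ (K R₀ θ_c : ℝ) (c : EuclideanSpace ℝ (Fin d) → ℝ),
        0 < K → 0 < R₀ → 0 < θ_c → PotentialAssumption p q_c K R₀ θ_c c →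
      ∀ (u : EuclideanSpace ℝ (Fin d) → ℝ) (R : ℝ≥0∞),
        ContDiff ℝ ∞ u → HasCompactSupport u → 0 < R →
        lpBall p R (fun x => c x * u x) ≤
            N * ENNReal.ofReal K *
              (lpBall p R (iteratedFDeriv ℝ 2 u) ^ ((d : ℝ) / (2 * q_c)) *
                  lpBall p R u ^ (1 - (d : ℝ) / (2 * q_c)) +
                R ^ (-((d : ℝ) / q_c)) * lpBall p R u) := by
  have hp0 : 0 < p := by linarith
  have hq0 : 0 < q_c := hp0.trans_le hpq
  have hd' : (0 : ℝ) < d := by exact_mod_cast hd0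
  have hδ2 : (d : ℝ) / q_c < 2 := by
    rw [div_lt_iff₀ hq0]; linarith
  have hδ0 : 0 < (d : ℝ) / q_c := by positivity
  obtain ⟨C, hC⟩ := exists_lintegral_mul_rieszSum_le_of_subcritical (F := ℝ) (d := d) (q := q_c)
    (α := 2) (δ := 2 - d / q_c) hp hpq (by norm_num) (by linarith)
  have hNt : reprConst d * C * 2 ≠ ⊤ :=
    ENNReal.mul_ne_top (ENNReal.mul_ne_top (reprConst_ne_top d) ENNReal.coe_ne_top) (by simp)
  obtain ⟨N, hN⟩ : ∃ N : ℝ≥0, (N : ℝ≥0∞) = reprConst d * C * 2 :=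
    ⟨_, ENNReal.coe_toNNReal hNt⟩
  refine ⟨N, fun K R₀ θ c hK _ _ hc u R hu hus hR => ?_⟩
  rw [hN, lpBall_iteratedFDeriv_two]
  have hcK : (∫⁻ x, ‖c x‖ₑ ^ q_c) ^ (1 / q_c) ≤ ENNReal.ofReal K := by
    rcases hc.cases with h | h
    · have h2 := h.2
      rwa [eLpNorm_eq_lintegral_rpow_enorm_toReal (by simpa using hq0) ENNReal.ofReal_ne_top,
        ENNReal.toReal_ofReal hq0.le] at h2
    · exact absurd h.1 (not_le.2 hq)
  have hu2 : ContDiff ℝ 2 u := by exact_mod_cast contDiff_infty.1 hu 2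
  have hdu : ContDiff ℝ 1 (fderiv ℝ u) := hu2.fderiv_right (by norm_num)
  have hddu : Continuous (fderiv ℝ (fderiv ℝ u)) := hdu.continuous_fderiv one_ne_zero
  have hscale : ∀ ρ : ℝ, 0 < ρ → ENNReal.ofReal ρ ≤ R → lpBall p R (fun x => c x * u x) ≤
      reprConst d * C * ENNReal.ofReal K * (ENNReal.ofReal (ρ ^ (2 - (d : ℝ) / q_c)) *
        (lpBall p R (fderiv ℝ (fderiv ℝ u)) +
          (ENNReal.ofReal ρ ^ 2)⁻¹ * lpBall p R u)) := by
    intro ρ hρ hρR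
    have hpot := hC ρ (ENNReal.ofReal K) c hρ hc.measurable hcK
    have h := lpBall_le_of_rieszSum_two hp.le hρ hρR (fv := fun x => c x * u x)
      (fun x => enorm_mul (c x) (u x)) hu2 hpot
    simpa only [mul_assoc] using h
  have hus1 : HasCompactSupport (fderiv ℝ u) := HasCompactSupport.fderiv ℝ hus
  have hus2 : HasCompactSupport (fderiv ℝ (fderiv ℝ u)) := HasCompactSupport.fderiv ℝ hus1
  have hA : lpBall p R (fderiv ℝ (fderiv ℝ u)) ≠ ⊤ := lpBall_ne_top p R hddu hus2
  have hB : lpBall p R u ≠ ⊤ := lpBall_ne_top p R hu2.continuous hus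
  have hN' : reprConst d * C * ENNReal.ofReal K ≠ ⊤ :=
    ENNReal.mul_ne_top (ENNReal.mul_ne_top (reprConst_ne_top d) ENNReal.coe_ne_top)
      ENNReal.ofReal_ne_top
  -- The `δ` of the interpolation is `d / q_c`, complementary in `2` to the `δ` of the potential
  -- bound.
  have h := le_interpolation hδ0 hδ2 hR.ne' hN' hA hB hscale
  have e : (d : ℝ) / (2 * q_c) = d / q_c / 2 := by field_simp
  rw [e, mul_right_comm _ (2 : ℝ≥0∞)]
  exact h

/-- The zeroth-order term estimate under a Morrey condition. -/
theorem exists_potential_bound (hd0 : 0 < d) (hp : 1 < p) {q_c K : ℝ} (hpq : p ≤ q_c)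
    (hq : q_c ≤ (d : ℝ) / 2) (hK : 0 < K) :
    ∃ N₀ : ℝ≥0,
      ∀ (R₀ θ_c : ℝ) (c : EuclideanSpace ℝ (Fin d) → ℝ),
        0 < R₀ → 0 < θ_c → PotentialAssumption p q_c K R₀ θ_c c →
      ∀ (u : EuclideanSpace ℝ (Fin d) → ℝ) (R : ℝ≥0∞),
        ContDiff ℝ ∞ u → HasCompactSupport u → 0 < R →
        lpBall p R (fun x => c x * u x) ≤
            N₀ * ENNReal.ofReal θ_c *
              (lpBall p R (iteratedFDeriv ℝ 2 u) +
                ((ENNReal.ofReal R₀ ^ 2)⁻¹ + (R ^ 2)⁻¹) * lpBall p R u) := by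
  have hp0 : 0 < p := by linarith
  obtain ⟨C, hC⟩ := exists_lintegral_enorm_mul_rieszSum_le (F := ℝ) hd0 hp hpq two_ne_zero
    (2 * K).toNNReal
  refine ⟨assembledConst d 2 C, fun R₀ θ c hR₀ hθ hc u R hu _ hR => ?_⟩
  obtain ⟨ρ, hρ, hρR₀, hρR, hscale⟩ := exists_scale hd0 hR₀ hR
  have hM : MorreyBound q_c 2 R₀ θ c := by
    rcases hc.cases with h | h
    · exact absurd h.1 (not_lt.2 hq)
    · exact h.2
  have hpot := hC ρ R₀ θ c hρ hρR₀ hθ hc.measurable (by simpa using hM)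
    fun h r hr => laverage_rpow_le_of_a1Const_le hp0 hK
      (by simpa only [Real.norm_eq_abs] using hc.a1 h hq) hr
  have hu2 : ContDiff ℝ 2 u := by exact_mod_cast contDiff_infty.1 hu 2
  have h := le_assembledConst_mul hd0 2 C (lpBall_le_of_rieszSum_two hp.le hρ hρR
    (fv := fun x => c x * u x) (fun x => enorm_mul _ _) hu2 hpot) (hscale 2)
  rwa [← lpBall_iteratedFDeriv_two, add_comm (R ^ 2)⁻¹] at h

end Assembly

theorem theorem3p9 (d : ℕ) (hd : 3 ≤ d) (p : ℝ) (hp : 1 < p) (hpd : p ≤ d) :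
    -- part (i)
    (∀ q_b K : ℝ, p ≤ q_b → q_b ≤ d → 0 < K → ∃ N₀ : ℝ≥0,
      ∀ (R₀ θ_b : ℝ) (b : EuclideanSpace ℝ (Fin d) → EuclideanSpace ℝ (Fin d)),
        0 < R₀ → 0 < θ_b → DriftAssumption p q_b K R₀ θ_b b →
      ∀ (u : EuclideanSpace ℝ (Fin d) → ℝ) (R : ℝ≥0∞),
        ContDiff ℝ ∞ u → HasCompactSupport u → 0 < R →
        lpBall p R (fun x => u x • b x) ≤
            N₀ * ENNReal.ofReal θ_b * lpBall p R (fderiv ℝ u) +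
            N₀ * ENNReal.ofReal θ_b * (R⁻¹ + (ENNReal.ofReal R₀)⁻¹) * lpBall p R u ∧
        lpBall p R (fun x => ‖b x‖ * ‖fderiv ℝ u x‖) ≤
            N₀ * ENNReal.ofReal θ_b * lpBall p R (iteratedFDeriv ℝ 2 u) +
            N₀ * ENNReal.ofReal θ_b * (R⁻¹ + (ENNReal.ofReal R₀)⁻¹) *
              lpBall p R (fderiv ℝ u)) ∧
    -- part (ii)
    (∀ q_c : ℝ, p ≤ q_c → (d : ℝ) / 2 < q_c → ∃ N : ℝ≥0,
      ∀ (K R₀ θ_c : ℝ) (c : EuclideanSpace ℝ (Fin d) → ℝ),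
        0 < K → 0 < R₀ → 0 < θ_c → PotentialAssumption p q_c K R₀ θ_c c →
      ∀ (u : EuclideanSpace ℝ (Fin d) → ℝ) (R : ℝ≥0∞),
        ContDiff ℝ ∞ u → HasCompactSupport u → 0 < R →
        lpBall p R (fun x => c x * u x) ≤
            N * ENNReal.ofReal K *
              (lpBall p R (iteratedFDeriv ℝ 2 u) ^ ((d : ℝ) / (2 * q_c)) *
                  lpBall p R u ^ (1 - (d : ℝ) / (2 * q_c)) +
                R ^ (-((d : ℝ) / q_c)) * lpBall p R u)) ∧
    -- part (iii)
    (∀ q_c K : ℝ, p ≤ q_c → q_c ≤ (d : ℝ) / 2 → 0 < K → ∃ N₀ : ℝ≥0,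
      ∀ (R₀ θ_c : ℝ) (c : EuclideanSpace ℝ (Fin d) → ℝ),
        0 < R₀ → 0 < θ_c → PotentialAssumption p q_c K R₀ θ_c c →
      ∀ (u : EuclideanSpace ℝ (Fin d) → ℝ) (R : ℝ≥0∞),
        ContDiff ℝ ∞ u → HasCompactSupport u → 0 < R →
        lpBall p R (fun x => c x * u x) ≤
            N₀ * ENNReal.ofReal θ_c *
              (lpBall p R (iteratedFDeriv ℝ 2 u) +
                ((ENNReal.ofReal R₀ ^ 2)⁻¹ + (R ^ 2)⁻¹) * lpBall p R u)) := by
  have hd0 : 0 < d := by omega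
  exact ⟨fun q K hpq _ hK => exists_drift_bound hd0 hp hpq hK,
    fun q hpq hq => exists_subcritical_potential_bound hd0 hp hpq hq,
    fun q K hpq hq hK => exists_potential_bound hd0 hp hpq hq hK⟩
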